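/- Let $(M,g)$ be a smooth 3-dimensional Lorentzian manifold. Let $\eta$ be the Lorentzian inner product on $V=\mathbb R^3$ with $\eta_{02}=\eta_{20}=-1$, $\eta_{11}=\tfrac12$ and all other components zero. Let $O(\eta)$ be its full automorphism group, and let $O(\eta,M)$ be the bundle of $\eta$-orthogonal frames $(e_0,e_1,e_2)$, that is, frames with $g(e_a,e_b)=\eta_{ab}$. For $p\ge 0$ put $\mathcal R^p=\otimes^4V^*\oplus\cdots\oplus\otimes^{4+p}V^*$. Let $\hat R^{(p)}:O(\eta,M)\to\mathcal R^p$ be the map sending a frame to the components $(R_{abcd},R_{abcd;e_1},\dots,R_{abcd;e_1\dots e_p})$ of the Riemann tensor and its first $p$ covariant derivatives in that frame. For a local moving frame, $R^{(p)}$ denotes the resulting $\mathcal R^p$-valued function on its domain. Definitions. * $(M,g)$ is *fully regular* if for every $p\ge0$ the rank $r_p$ of $\hat R^{(p)}$ is constant on $O(\eta,M)$. With $r_{-1}=0$, its *order* is $q-1$, where $q\ge 0$ is the smallest integer with $r_{q-1}=r_q$. * A $p$th order *normalizing cross-section* is a submanifold $S\subset\mathcal R^p$ for which there is a subgroup $G_p\subset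 O(\eta)$ such that: $G_p$ fixes $S$ pointwise; if $X\in O(\eta)$ and $X(S)\cap S\ne\emptyset$ then $X\in G_p$; and $M$ is covered by domains of $\eta$-orthogonal moving frames with $R^{(p)}$ taking values in $S$. $(M,g)$ is *curvature regular* if such a cross-section exists for every $p\ge0$. The *horizontal rank* $t_p$ is the rank of $R^{(p)}$ relative to moving frames normalized in this way (for some choice of $S$). * $(M,g)$ is *properly $\mathrm{CH}_1$* (properly curvature homogeneous of order 1) if it is curvature regular, $t_1=0$ and $t_2>0$. * Let $S_{ab}=R_{ab}-\tfrac13Rg_{ab}$ be the trace-free Ricci tensor, and for an $\eta$-orthogonal frame put $\Psi_0=S_{00}$, $\Psi_1=S_{01}$, $\Psi_2=S_{02}$, $\Psi_3=S_{12}$, $\Psi_4=S_{22}$. $(M,g)$ is of *type N* if at every point, relative to an $\eta$-orthogonal frame with $\Psi_4\neq0$, the real quartic $\Psi_0+4\Psi_1z+6\Psi_2z^2+4\Psi_3z^3+\Psi_4z^4$ has a quadruple real root. **Proposition.** If $(M,g)$ is fully regular, of type N and properly $\mathrm{CH}_1$, then its order satisfies $q-1\le 3$. -/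

import Mathlib

open scoped Manifold ContDiff Topology Matrix

noncomputable section

namespace Lorentz3

/-! ### The model inner product and its automorphism group -/

/-- The Lorentzian inner product on `ℝ³` in a null triad `(ℓ, m, n)`:
`η(ℓ, n) = -1`, `η(m, m) = 1/2`, all other products zero. -/
def eta : Matrix (Fin 3) (Fin 3) ℝ := !![0, 0, -1; 0, 1 / 2, 0; -1, 0, 0]

/-- The inverse matrix `η^{ab}` of `eta`. -/
def etaInv : Matrix (Fin 3) (Fin 3) ℝ := !![0, 0, -1; 0, 2, 0; -1, 0, 0]

lemma eta_mul_etaInv : eta * etaInv = 1 := by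
  ext i j
  fin_cases i <;> fin_cases j <;> simp [eta, etaInv, Matrix.mul_apply, Fin.sum_univ_three]

/-- The full group `O(η)` of linear automorphisms of the inner product `η`. -/
def lorentzGroup : Subgroup (GL (Fin 3) ℝ) where
  carrier := {X | (X : Matrix (Fin 3) (Fin 3) ℝ)ᵀ * eta * (X : Matrix (Fin 3) (Fin 3) ℝ) = eta}
  one_mem' := by simp
  mul_mem' := by
    intro X Y hX hY
    simp only [Set.mem_ofPred_eq, Units.val_mul, Matrix.transpose_mul] at *
    calc _ = (Y : Matrix (Fin 3) (Fin 3) ℝ)ᵀ *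
            ((X : Matrix (Fin 3) (Fin 3) ℝ)ᵀ * eta * (X : Matrix (Fin 3) (Fin 3) ℝ)) *
            (Y : Matrix (Fin 3) (Fin 3) ℝ) := by simp only [Matrix.mul_assoc]
      _ = eta := by rw [hX, hY]
  inv_mem' := by
    intro X hX
    simp only [Set.mem_ofPred_eq] at *
    have h1 : (X : Matrix (Fin 3) (Fin 3) ℝ) * ((X⁻¹ : GL (Fin 3) ℝ) : Matrix _ _ ℝ) = 1 :=
      Units.mul_inv X
    have h2 : ((X⁻¹ : GL (Fin 3) ℝ) : Matrix (Fin 3) (Fin 3) ℝ)ᵀ *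
        (X : Matrix (Fin 3) (Fin 3) ℝ)ᵀ = 1 := by
      rw [← Matrix.transpose_mul, h1, Matrix.transpose_one]
    calc ((X⁻¹ : GL (Fin 3) ℝ) : Matrix (Fin 3) (Fin 3) ℝ)ᵀ * eta *
            ((X⁻¹ : GL (Fin 3) ℝ) : Matrix (Fin 3) (Fin 3) ℝ)
        = ((X⁻¹ : GL (Fin 3) ℝ) : Matrix (Fin 3) (Fin 3) ℝ)ᵀ *
            ((X : Matrix (Fin 3) (Fin 3) ℝ)ᵀ * eta * (X : Matrix (Fin 3) (Fin 3) ℝ)) *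
            ((X⁻¹ : GL (Fin 3) ℝ) : Matrix (Fin 3) (Fin 3) ℝ) := by rw [hX]
      _ = (((X⁻¹ : GL (Fin 3) ℝ) : Matrix (Fin 3) (Fin 3) ℝ)ᵀ *
            (X : Matrix (Fin 3) (Fin 3) ℝ)ᵀ) * eta *
            ((X : Matrix (Fin 3) (Fin 3) ℝ) *
              ((X⁻¹ : GL (Fin 3) ℝ) : Matrix (Fin 3) (Fin 3) ℝ)) := by
          simp only [Matrix.mul_assoc]
      _ = eta := by rw [h1, h2, Matrix.one_mul, Matrix.mul_one]

/-- The vector space `𝓡^p = ⊗⁴ V* ⊕ ⋯ ⊕ ⊗^{4+p} V*`, where an element of `⊗^k V*` is given by its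
components `T_{a₁ … a_k}`. -/
abbrev CurvSpace (p : ℕ) : Type := (k : Fin (p + 1)) → (Fin (4 + (k : ℕ)) → Fin 3) → ℝ

/-- The action of `O(η)` on `𝓡^p`:
`(X · T)(v₁, …, v_k) = T(X⁻¹ v₁, …, X⁻¹ v_k)` in each summand. -/
def act {p : ℕ} (X : lorentzGroup) (T : CurvSpace p) : CurvSpace p :=
  fun k a => ∑ b : Fin (4 + (k : ℕ)) → Fin 3,
    (∏ i, ((X⁻¹ : lorentzGroup) : GL (Fin 3) ℝ).val (b i) (a i)) * T k b

/-- `S` is a smooth embedded submanifold of the vector space `F`: around each of its points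
there is a smooth chart of `F` in which `S` is a linear subspace. -/
def IsEmbeddedSubmanifold {F : Type*} [NormedAddCommGroup F] [NormedSpace ℝ F]
    (S : Set F) : Prop :=
  ∀ s ∈ S, ∃ (Φ : OpenPartialHomeomorph F F) (W : Submodule ℝ F),
    s ∈ Φ.source ∧ ContDiffOn ℝ ∞ Φ Φ.source ∧ ContDiffOn ℝ ∞ Φ.symm Φ.target ∧
      ∀ y ∈ Φ.source, (y ∈ S ↔ Φ y ∈ W)

/-! ### Lorentzian metrics and moving frames -/

variable {M : Type*} [TopologicalSpace M] [ChartedSpace (EuclideanSpace ℝ (Fin 3)) M]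
  [IsManifold (𝓡 3) ∞ M]

variable (M) in
/-- A smooth Lorentzian metric on a 3-dimensional manifold. -/
structure LorentzMetric where
  /-- the inner product on each tangent space -/
  val : ∀ x : M, TangentSpace (𝓡 3) x →L[ℝ] TangentSpace (𝓡 3) x →L[ℝ] ℝ
  symm : ∀ (x : M) (v w : TangentSpace (𝓡 3) x), val x v w = val x w v
  /-- every tangent space has a null triad, i.e. is isometric to `(ℝ³, η)` -/
  signature : ∀ x : M, ∃ u : Fin 3 → TangentSpace (𝓡 3) x, ∀ a b, val x (u a) (u b) = eta a b
  contMDiff : ContMDiff (𝓡 3)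
    ((𝓡 3).prod 𝓘(ℝ, EuclideanSpace ℝ (Fin 3) →L[ℝ] EuclideanSpace ℝ (Fin 3) →L[ℝ] ℝ)) ∞
    (fun x => Bundle.TotalSpace.mk'
      (EuclideanSpace ℝ (Fin 3) →L[ℝ] EuclideanSpace ℝ (Fin 3) →L[ℝ] ℝ)
      (E := fun x : M => TangentSpace (𝓡 3) x →L[ℝ] TangentSpace (𝓡 3) x →L[ℝ] ℝ) x (val x))

variable (M) in
/-- Triples `(e₀, e₁, e₂)` of vector fields. -/
abbrev Frame := Fin 3 → ∀ x : M, TangentSpace (𝓡 3) x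

/-- `e` is a smooth `η`-orthogonal moving frame on the open set `U`, i.e. `g(e_a, e_b) = η_{ab}`;
equivalently, its dual coframe `ω^a` satisfies `g = η_{ab} ω^a ω^b` on `U`.
The values of `e` outside `U` play no role. -/
structure IsMovingFrame (g : LorentzMetric M) (e : Frame M) (U : Set M) : Prop where
  isOpen : IsOpen U
  contMDiffOn : ∀ a, ContMDiffOn (𝓡 3) (𝓡 3).tangent ∞
    (fun x => (⟨x, e a x⟩ : TangentBundle (𝓡 3) M)) U
  orthogonal : ∀ x ∈ U, ∀ a b, g.val x (e a x) (e b x) = eta a b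

/-- The frame `e X`, `(e X)_a = X^b_a e_b`, for a constant matrix `X`. -/
def rotate (e : Frame M) (X : Matrix (Fin 3) (Fin 3) ℝ) : Frame M :=
  fun a x => ∑ b, X b a • e b x

/-! ### Curvature components relative to a moving frame -/

/-- The derivative `e_a(f)` of a scalar function along the frame vector `e_a`. -/
def frameDeriv (e : Frame M) (a : Fin 3) (f : M → ℝ) (x : M) : ℝ :=
  mfderiv (𝓡 3) 𝓘(ℝ, ℝ) f x (e a x)

/-- `g([e_a, e_b], e_c)`. -/
def structLow (g : LorentzMetric M) (e : Frame M) (a b c : Fin 3) (x : M) : ℝ :=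
  g.val x (VectorField.mlieBracket (𝓡 3) (e a) (e b) x) (e c x)

/-- The structure functions `C^c_{ab}`: `[e_a, e_b] = C^c_{ab} e_c`. -/
def struct (g : LorentzMetric M) (e : Frame M) (c a b : Fin 3) (x : M) : ℝ :=
  ∑ d, etaInv c d * structLow g e a b d x

/-- `g(∇_{e_a} e_b, e_c)` for the Levi-Civita connection, by the Koszul formula
(in which the derivatives of the constants `g(e_a, e_b)` vanish). -/
def connLow (g : LorentzMetric M) (e : Frame M) (a b c : Fin 3) (x : M) : ℝ :=
  (structLow g e a b c x - structLow g e a c b x - structLow g e b c a x) / 2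

/-- The connection components `Γ^c_{ab}`: `∇_{e_a} e_b = Γ^c_{ab} e_c`. -/
def conn (g : LorentzMetric M) (e : Frame M) (c a b : Fin 3) (x : M) : ℝ :=
  ∑ d, etaInv c d * connLow g e a b d x

/-- `R^a_{bcd}`, where
`R^a_{bcd} e_a = ∇_{e_c} ∇_{e_d} e_b - ∇_{e_d} ∇_{e_c} e_b - ∇_{[e_c, e_d]} e_b`. -/
def riemUp (g : LorentzMetric M) (e : Frame M) (a b c d : Fin 3) (x : M) : ℝ :=
  frameDeriv e c (conn g e a d b) x - frameDeriv e d (conn g e a c b) x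
    + ∑ f, (conn g e a c f x * conn g e f d b x - conn g e a d f x * conn g e f c b x
      - struct g e f c d x * conn g e a f b x)

/-- `R_{abcd} = η_{af} R^f_{bcd}`. -/
def riem (g : LorentzMetric M) (e : Frame M) (a b c d : Fin 3) (x : M) : ℝ :=
  ∑ f, eta a f * riemUp g e f b c d x

/-- The components `T_{a₁ … a_k; f}` of the covariant derivative of the covariant tensor with
components `T_{a₁ … a_k}` (the derivative index is the last one):
`e_f(T_{a₁ … a_k}) - ∑ᵢ Γ^b_{f aᵢ} T_{a₁ … b … a_k}`. -/
def covDeriv (g : LorentzMetric M) (e : Frame M) {k : ℕ} (T : (Fin k → Fin 3) → M → ℝ)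
    (a : Fin (k + 1) → Fin 3) (x : M) : ℝ :=
  frameDeriv e (a (Fin.last k)) (T (Fin.init a)) x
    - ∑ i : Fin k, ∑ b : Fin 3,
        conn g e b (a (Fin.last k)) (a i.castSucc) x * T (Function.update (Fin.init a) i b) x

/-- The components `R_{abcd; f₁ … f_p}` of the `p`-th covariant derivative of the Riemann tensor
relative to the moving frame `e`. -/
def curvComp (g : LorentzMetric M) (e : Frame M) : (p : ℕ) → (Fin (4 + p) → Fin 3) → M → ℝ
  | 0 => fun a => riem g e (a 0) (a 1) (a 2) (a 3)
  | p + 1 => covDeriv g e (curvComp g e p)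

/-- `R^{(p)} = (R_{abcd}, …, R_{abcd; f₁ … f_p})` relative to the moving frame `e`. -/
def curvJet (g : LorentzMetric M) (e : Frame M) (p : ℕ) (x : M) : CurvSpace p :=
  fun k a => curvComp g e k a x

/-! ### Rank of the lifted curvature map and order of the metric -/

/-- The canonical map `R̂^{(p)} : O(η, M) → 𝓡^p` on the bundle of `η`-orthogonal frames, in the
local trivialization `U × O(η) → O(η, M)`, `(y, X) ↦ e(y) X`, given by a moving frame `e` on `U`. -/
def liftedCurvJet (g : LorentzMetric M) (e : Frame M) (p : ℕ) (y : M) (X : lorentzGroup) :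
    CurvSpace p :=
  curvJet g (rotate e ((X : GL (Fin 3) ℝ) : Matrix (Fin 3) (Fin 3) ℝ)) p y

/-- The image of the differential of `R̂^{(p)}` at the frame `e(x) ∈ O(η, M)`, spanned by the
velocities of `R̂^{(p)}` along the smooth curves in `O(η, M)` through that frame. -/
def liftedVelocities (g : LorentzMetric M) (e : Frame M) (p : ℕ) (x : M) : Set (CurvSpace p) :=
  {w | ∃ (y : ℝ → M) (X : ℝ → lorentzGroup),
    ContMDiffAt 𝓘(ℝ, ℝ) (𝓡 3) ∞ y 0 ∧
    (∀ a b, ContDiffAt ℝ ∞ (fun t => ((X t : lorentzGroup) : GL (Fin 3) ℝ).val a b) 0) ∧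
    y 0 = x ∧ X 0 = 1 ∧ w = deriv (fun t => liftedCurvJet g e p (y t) (X t)) 0}

/-- The rank of `R̂^{(p)} : O(η, M) → 𝓡^p` at the frame `e(x)`. -/
def liftedRankAt (g : LorentzMetric M) (e : Frame M) (p : ℕ) (x : M) : ℕ :=
  Module.finrank ℝ (Submodule.span ℝ (liftedVelocities g e p x))

/-- `r_p = r`: the rank of `R̂^{(p)}` equals `r` at every point of `O(η, M)`. (Each point of
`O(η, M)` is the value `e(x)` of some moving frame.) -/
def HasRank (g : LorentzMetric M) (p r : ℕ) : Prop :=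
  ∀ (e : Frame M) (U : Set M), IsMovingFrame g e U → ∀ x ∈ U, liftedRankAt g e p x = r

/-- `(M, g)` is fully regular: `r_p` is constant for every `p`. -/
def FullyRegular (g : LorentzMetric M) : Prop := ∀ p, ∃ r, HasRank g p r

/-- `r_{q-1}`, with the convention `r_{-1} = 0`. -/
def prevRank (r : ℕ → ℕ) : ℕ → ℕ
  | 0 => 0
  | q + 1 => r q

/-- The metric has order `m = q - 1`, where `q` is the smallest integer with `r_{q-1} = r_q`. -/
def HasOrder (g : LorentzMetric M) (m : ℤ) : Prop :=
  ∃ r : ℕ → ℕ, (∀ p, HasRank g p (r p)) ∧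
    ∃ q : ℕ, IsLeast {q : ℕ | prevRank r q = r q} q ∧ m = (q : ℤ) - 1

/-! ### Curvature regularity, horizontal rank, curvature homogeneity -/

/-- `e` is a moving frame on `U` relative to which `R^{(p)}` takes values in `S`. -/
def IsNormalizedFrame (g : LorentzMetric M) (p : ℕ) (S : Set (CurvSpace p)) (e : Frame M)
    (U : Set M) : Prop :=
  IsMovingFrame g e U ∧ ∀ y ∈ U, curvJet g e p y ∈ S

/-- `S ⊆ 𝓡^p` is a `p`-th order normalizing cross-section for `(M, g)`, with group `G_p = G`. -/
structure IsNormalizingCrossSection (g : LorentzMetric M) (p : ℕ) (S : Set (CurvSpace p))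
    (G : Subgroup lorentzGroup) : Prop where
  submanifold : IsEmbeddedSubmanifold S
  fixes : ∀ X ∈ G, ∀ s ∈ S, act X s = s
  maximal : ∀ X : lorentzGroup, (act X '' S ∩ S).Nonempty → X ∈ G
  cover : ∀ x : M, ∃ (e : Frame M) (U : Set M), x ∈ U ∧ IsNormalizedFrame g p S e U

/-- `(M, g)` is curvature regular: there is a normalizing cross-section of every order. -/
def CurvatureRegular (g : LorentzMetric M) : Prop :=
  ∀ p, ∃ (S : Set (CurvSpace p)) (G : Subgroup lorentzGroup), IsNormalizingCrossSection g p S G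

/-- The rank of `R^{(p)}`, relative to the moving frame `e`, at the point `x`. -/
def jetRankAt (g : LorentzMetric M) (e : Frame M) (p : ℕ) (x : M) : ℕ :=
  Module.finrank ℝ
    (LinearMap.range (mfderiv (𝓡 3) 𝓘(ℝ, CurvSpace p) (curvJet g e p) x).toLinearMap)

/-- The `p`-th order horizontal rank is `t_p = t`: relative to some choice of normalizing
cross-section, the normalized `R^{(p)}` has rank `t` everywhere. -/
def HasHorizontalRank (g : LorentzMetric M) (p t : ℕ) : Prop :=
  ∃ (S : Set (CurvSpace p)) (G : Subgroup lorentzGroup), IsNormalizingCrossSection g p S G ∧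
    ∀ (e : Frame M) (U : Set M), IsNormalizedFrame g p S e U → ∀ x ∈ U, jetRankAt g e p x = t

/-- `(M, g)` is properly curvature homogeneous of order `k`: it is curvature regular,
`t_k = 0` and `t_{k+1} > 0`. -/
def IsProperlyCH (g : LorentzMetric M) (k : ℕ) : Prop :=
  CurvatureRegular g ∧ HasHorizontalRank g k 0 ∧ ∃ t, 0 < t ∧ HasHorizontalRank g (k + 1) t

/-! ### Petrov type N -/

/-- The Ricci tensor `R_{ab} = R^c_{acb}`. -/
def ricci (g : LorentzMetric M) (e : Frame M) (a b : Fin 3) (x : M) : ℝ :=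
  ∑ c, riemUp g e c a c b x

/-- The curvature scalar `R = R^a_a`. -/
def scalarCurv (g : LorentzMetric M) (e : Frame M) (x : M) : ℝ :=
  ∑ a, ∑ b, etaInv a b * ricci g e a b x

/-- The trace-free Ricci tensor `S_{ab} = R_{ab} - (R/3) g_{ab}`. -/
def tracefreeRicci (g : LorentzMetric M) (e : Frame M) (a b : Fin 3) (x : M) : ℝ :=
  ricci g e a b x - scalarCurv g e x / 3 * eta a b

/-- The real quartic `Ψ₀ + 4 Ψ₁ z + 6 Ψ₂ z² + 4 Ψ₃ z³ + Ψ₄ z⁴`, where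
`Ψ₀ = S₀₀, Ψ₁ = S₀₁, Ψ₂ = S₀₂, Ψ₃ = S₁₂, Ψ₄ = S₂₂`. -/
def petrovQuartic (g : LorentzMetric M) (e : Frame M) (x : M) (z : ℝ) : ℝ :=
  tracefreeRicci g e 0 0 x + 4 * tracefreeRicci g e 0 1 x * z
    + 6 * tracefreeRicci g e 0 2 x * z ^ 2 + 4 * tracefreeRicci g e 1 2 x * z ^ 3
    + tracefreeRicci g e 2 2 x * z ^ 4

/-- The curvature is of Petrov type N at `x`: relative to a null triad with `Ψ₄ ≠ 0`, the quartic
has a quadruple real root. -/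
def IsTypeNAt (g : LorentzMetric M) (x : M) : Prop :=
  ∃ (e : Frame M) (U : Set M), IsMovingFrame g e U ∧ x ∈ U ∧
    tracefreeRicci g e 2 2 x ≠ 0 ∧
    ∃ z₀ : ℝ, ∀ z : ℝ, petrovQuartic g e x z = tracefreeRicci g e 2 2 x * (z - z₀) ^ 4

/-- `(M, g)` is of Petrov type N (at every point). -/
def IsTypeN (g : LorentzMetric M) : Prop := ∀ x : M, IsTypeNAt g x

end Lorentz3

end

open scoped Manifold ContDiff Topology Matrix
set_option linter.unusedSectionVars false
set_option linter.style.haveILetI false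
set_option linter.unusedSimpArgs false

noncomputable section

namespace Lorentz3

variable {M : Type*} [TopologicalSpace M] [ChartedSpace (EuclideanSpace ℝ (Fin 3)) M]
  [IsManifold (𝓡 3) ∞ M]

/-! The order is controlled by counting ranks. Since r_p is nondecreasing, it suffices to find q ≤ 4
with r_{q-1} = r_q, and this follows from three bounds: r_0 ≥ 2 always (`two_le_rank_zero`), and
either r_1 ≤ 2 or r_p ≤ 5 for all p (`rank_bounds`). In the first case r_0 = r_1; in the second r_0
< r_1 < r_2 < r_3 < r_4 would force r_4 ≥ 6.

A type N metric has null frames in which the curvature is a constant-curvature part K plus s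
(ω¹∧ω²)², with s ≠ 0. The boost and the null rotation about e_2 move this tensor independently,
while the null rotation about e_0 fixes it. Vanishing of t_1 gives near each point such a frame in
which R and ∇R have constant components (`exists_const_frame`). As ∇R is linear in α_f = Γ⁰_{f0} and
β_f = Γ¹_{f0} (`curvComp_one`), these are then constants.

The second Bianchi identity and the curvature equations give α_0 = β_0 = β_1 = 0 together with
equations for the remaining functions γ_f = Γ⁰_{f1} (`structure_eqs`). If β_2 = 2α_1, then ∇R is
also fixed by the null rotation about e_0, so only two vertical directions contribute to r_1.
Otherwise γ_0 and γ_1 are constant and e_0 annihilates γ_2; moreover [e_0, e_a] is a multiple of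
e_0. By induction e_0 annihilates the components of every covariant derivative of the curvature, so
one of the six directions on the frame bundle never contributes.

To compute these ranks, the lifted map is made explicit by the tensorial behaviour of the curvature
jet under constant rotations (`curvComp_rotate`). Its velocities then lie in the span of three frame
derivatives and three infinitesimal rotations. -/

lemma two_le_smooth : (2 : WithTop ℕ∞) ≤ ∞ := by
  exact WithTop.coe_le_coe.2 (le_top : (2 : ℕ∞) ≤ ⊤)

lemma three_le_smooth : (3 : WithTop ℕ∞) ≤ ∞ := by
  exact WithTop.coe_le_coe.2 (le_top : (3 : ℕ∞) ≤ ⊤)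

/-! ### Smooth functions and vector fields on an open set -/

/-- `f` is a smooth function on `U`. -/
abbrev SmoothFun (U : Set M) (f : M → ℝ) : Prop := ContMDiffOn (𝓡 3) 𝓘(ℝ, ℝ) ∞ f U

/-- `V` is a smooth vector field on `U`. -/
abbrev SmoothField (U : Set M) (V : ∀ x : M, TangentSpace (𝓡 3) x) : Prop :=
  ContMDiffOn (𝓡 3) (𝓡 3).tangent ∞ (fun x => (⟨x, V x⟩ : TangentBundle (𝓡 3) M)) U

/-- The derivative of the function `f` along the vector field `V`. -/
def dirDeriv (V : ∀ x : M, TangentSpace (𝓡 3) x) (f : M → ℝ) (x : M) : ℝ :=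
  mfderiv (𝓡 3) 𝓘(ℝ, ℝ) f x (V x)

lemma frameDeriv_eq_dirDeriv (e : Frame M) (a : Fin 3) (f : M → ℝ) (x : M) :
    frameDeriv e a f x = dirDeriv (e a) f x := rfl

section
variable {U : Set M} {x : M} {f f' : M → ℝ} {V W Z : ∀ x : M, TangentSpace (𝓡 3) x}

lemma SmoothFun.mdiffAt (hf : SmoothFun U f) (hU : IsOpen U) (hx : x ∈ U) :
    MDifferentiableAt (𝓡 3) 𝓘(ℝ, ℝ) f x :=
  (hf.contMDiffAt (hU.mem_nhds hx)).mdifferentiableAt (by simp)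

lemma SmoothField.mdiffAt (hV : SmoothField U V) (hU : IsOpen U) (hx : x ∈ U) :
    MDifferentiableAt (𝓡 3) (𝓡 3).tangent
      (fun x => (⟨x, V x⟩ : TangentBundle (𝓡 3) M)) x :=
  (hV.contMDiffAt (hU.mem_nhds hx)).mdifferentiableAt (by simp)

/-- The derivative is the fibre component of the tangent map of `f` composed with the section `V`.
-/
lemma smoothFun_dirDeriv (hU : IsOpen U) (hf : SmoothFun U f) (hV : SmoothField U V) :
    SmoothFun U (dirDeriv V f) := by
  have h1 : ContMDiffOn (𝓡 3) (𝓘(ℝ, ℝ)).tangent ∞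
      (fun x => tangentMapWithin (𝓡 3) 𝓘(ℝ, ℝ) f U ⟨x, V x⟩) U :=
    (hf.contMDiffOn_tangentMapWithin (m := ∞) (by simp) hU.uniqueMDiffOn).comp hV
      (fun x hx => hx)
  have h2 := (contMDiff_snd_tangentBundle_modelSpace ℝ 𝓘(ℝ, ℝ) (n := ∞)).comp_contMDiffOn h1
  refine h2.congr fun y hy => ?_
  simp only [dirDeriv, Function.comp, tangentMapWithin]
  rw [mfderivWithin_of_isOpen hU hy]

lemma smoothField_mlieBracket (hU : IsOpen U) (hV : SmoothField U V) (hW : SmoothField U W) :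
    SmoothField U (VectorField.mlieBracket (𝓡 3) V W) := by
  intro x hx
  refine ContMDiffAt.contMDiffWithinAt ?_
  haveI : IsManifold (𝓡 3) (((⊤ : ℕ∞) : WithTop ℕ∞) + 1) M := by
    simpa using (inferInstance : IsManifold (𝓡 3) ∞ M)
  haveI : IsManifold (𝓡 3) (minSmoothness ℝ 2) M :=
    .of_le (n := ∞) (by simpa using two_le_smooth)
  exact ContMDiffAt.mlieBracket_vectorField (m := ⊤) (n := ⊤)
    (hV.contMDiffAt (hU.mem_nhds hx)) (hW.contMDiffAt (hU.mem_nhds hx)) (by simp)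

lemma smoothFun_inner (g : LorentzMetric M) (hV : SmoothField U V) (hW : SmoothField U W) :
    SmoothFun U (fun x => g.val x (V x) (W x)) := by
  have : ContMDiffOn (𝓡 3) ((𝓡 3).prod 𝓘(ℝ, ℝ)) ∞
      (fun m ↦ Bundle.TotalSpace.mk' ℝ (E := Bundle.Trivial M ℝ) m (g.val m (V m) (W m))) U := by
    intro x hx
    apply ContMDiffWithinAt.clm_bundle_apply₂ (F₁ := EuclideanSpace ℝ (Fin 3))
      (F₂ := EuclideanSpace ℝ (Fin 3))
    · exact g.contMDiff.contMDiffAt.contMDiffWithinAt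
    · exact hV x hx
    · exact hW x hx
  intro x hx
  have := this x hx
  simp only [Bundle.contMDiffWithinAt_totalSpace] at this
  exact this.2

lemma dirDeriv_add (hf : MDifferentiableAt (𝓡 3) 𝓘(ℝ, ℝ) f x)
    (hf' : MDifferentiableAt (𝓡 3) 𝓘(ℝ, ℝ) f' x) :
    dirDeriv V (fun y => f y + f' y) x = dirDeriv V f x + dirDeriv V f' x := by
  have := congrArg (fun T => T (V x)) (mvfderiv_add hf hf')
  simpa [dirDeriv, mvfderiv] using! this

lemma dirDeriv_neg : dirDeriv V (fun y => - f y) x = - dirDeriv V f x := by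
  have := congrArg (fun T => T (V x)) (mvfderiv_neg (I := 𝓡 3) (g := f) (x := x))
  simpa [dirDeriv, mvfderiv] using! this

lemma dirDeriv_sub (hf : MDifferentiableAt (𝓡 3) 𝓘(ℝ, ℝ) f x)
    (hf' : MDifferentiableAt (𝓡 3) 𝓘(ℝ, ℝ) f' x) :
    dirDeriv V (fun y => f y - f' y) x = dirDeriv V f x - dirDeriv V f' x := by
  have := congrArg (fun T => T (V x)) (mvfderiv_sub hf hf')
  simpa [dirDeriv, mvfderiv] using! this

lemma dirDeriv_mul (hf : MDifferentiableAt (𝓡 3) 𝓘(ℝ, ℝ) f x)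
    (hf' : MDifferentiableAt (𝓡 3) 𝓘(ℝ, ℝ) f' x) :
    dirDeriv V (fun y => f y * f' y) x = f x * dirDeriv V f' x + f' x * dirDeriv V f x := by
  have := congrArg (fun T => T (V x)) (mvfderiv_mul hf hf')
  simpa [dirDeriv, mvfderiv] using! this

lemma dirDeriv_const (c : ℝ) : dirDeriv V (fun _ => c) x = 0 := by
  rw [dirDeriv, mfderiv_const]; rfl

lemma dirDeriv_congr (h : f =ᶠ[𝓝 x] f') : dirDeriv V f x = dirDeriv V f' x := by
  rw [dirDeriv, dirDeriv, h.mfderiv_eq]; rfl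

lemma dirDeriv_const_mul (c : ℝ) (hf : MDifferentiableAt (𝓡 3) 𝓘(ℝ, ℝ) f x) :
    dirDeriv V (fun y => c * f y) x = c * dirDeriv V f x := by
  rw [dirDeriv_mul mdifferentiableAt_const hf, dirDeriv_const]; ring

lemma dirDeriv_sum {ι : Type*} (s : Finset ι) {F : ι → M → ℝ}
    (hF : ∀ i ∈ s, MDifferentiableAt (𝓡 3) 𝓘(ℝ, ℝ) (F i) x) :
    dirDeriv V (fun y => ∑ i ∈ s, F i y) x = ∑ i ∈ s, dirDeriv V (F i) x := by
  classical
  induction s using Finset.induction_on with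
  | empty => simpa using dirDeriv_const 0
  | insert i s hi ih =>
    simp only [Finset.sum_insert hi]
    rw [dirDeriv_add (hF i (by simp)), ih fun j hj => hF j (by simp [hj])]
    have : ∀ s' : Finset ι, (∀ i ∈ s', MDifferentiableAt (𝓡 3) 𝓘(ℝ, ℝ) (F i) x) →
        MDifferentiableAt (𝓡 3) 𝓘(ℝ, ℝ) (fun y => ∑ i ∈ s', F i y) x := by
      intro s'
      induction s' using Finset.induction_on with
      | empty => intro _; simpa using mdifferentiableAt_const
      | insert i s hi ih =>
        intro h
        simp only [Finset.sum_insert hi]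
        exact (h i (by simp)).add (ih fun j hj => h j (by simp [hj]))
    exact this s fun j hj => hF j (by simp [hj])

lemma mlieBracket_smul_right' (hf : MDifferentiableAt (𝓡 3) 𝓘(ℝ, ℝ) f x)
    (hW : MDifferentiableAt (𝓡 3) (𝓡 3).tangent
      (fun x => (⟨x, W x⟩ : TangentBundle (𝓡 3) M)) x) :
    VectorField.mlieBracket (𝓡 3) V (fun y => f y • W y) x =
      dirDeriv V f x • W x + f x • VectorField.mlieBracket (𝓡 3) V W x := by
  haveI : IsManifold (𝓡 3) 2 M := .of_le (n := ∞) two_le_smooth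
  have := VectorField.mlieBracket_smul_right (I := 𝓡 3) (V := V) hf hW
  exact this

lemma SmoothField.smul (hf : SmoothFun U f) (hV : SmoothField U V) :
    SmoothField U (fun y => f y • V y) := ContMDiffOn.smul_section hf hV

lemma SmoothField.sum {ι : Type*} (s : Finset ι) {V : ι → ∀ x : M, TangentSpace (𝓡 3) x}
    (hV : ∀ i ∈ s, SmoothField U (V i)) :
    SmoothField U (fun y => ∑ i ∈ s, V i y) := ContMDiffOn.sum_section hV

lemma mlieBracket_sum_right {ι : Type*} (s : Finset ι) (hU : IsOpen U) (hx : x ∈ U)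
    {W : ι → ∀ x : M, TangentSpace (𝓡 3) x} (hW : ∀ i ∈ s, SmoothField U (W i)) :
    VectorField.mlieBracket (𝓡 3) V (fun y => ∑ i ∈ s, W i y) x =
      ∑ i ∈ s, VectorField.mlieBracket (𝓡 3) V (W i) x := by
  haveI : IsManifold (𝓡 3) 2 M := .of_le (n := ∞) two_le_smooth
  classical
  induction s using Finset.induction_on with
  | empty =>
    simp only [Finset.sum_empty]
    exact congrFun (VectorField.mlieBracket_zero_right (I := 𝓡 3) (W := V)) x
  | insert i s hi ih =>
    simp only [Finset.sum_insert hi]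
    rw [← ih fun j hj => hW j (by simp [hj])]
    exact VectorField.mlieBracket_add_right ((hW i (by simp)).mdiffAt hU hx)
      ((SmoothField.sum s fun j hj => hW j (by simp [hj])).mdiffAt hU hx)

/-- The commutator of two derivations of functions is the derivative along the Lie bracket. -/
lemma dirDeriv_comm (hU : IsOpen U) (hx : x ∈ U) (hV : SmoothField U V) (hW : SmoothField U W)
    (hZ : SmoothField U Z) (hZx : Z x ≠ 0) (hf : SmoothFun U f) :
    dirDeriv V (dirDeriv W f) x - dirDeriv W (dirDeriv V f) x =
      dirDeriv (VectorField.mlieBracket (𝓡 3) V W) f x := by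
  haveI : IsManifold (𝓡 3) 2 M := .of_le (n := ∞) two_le_smooth
  haveI : IsManifold (𝓡 3) (minSmoothness ℝ 3) M :=
    .of_le (n := ∞) (by simpa using three_le_smooth)
  have sm : ∀ {V : ∀ x : M, TangentSpace (𝓡 3) x}, SmoothField U V →
      ContMDiffAt (𝓡 3) (𝓡 3).tangent (minSmoothness ℝ 2)
        (fun x => (⟨x, V x⟩ : TangentBundle (𝓡 3) M)) x := fun h =>
    (h.contMDiffAt (hU.mem_nhds hx)).of_le (by simpa using two_le_smooth)
  -- The Jacobi identity is applied to `Z` and to `f • Z`. After expanding the second and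
  -- subtracting `f` times the first, only the desired commutator times `Z` survives, and `Z x ≠ 0`
  -- lets it be cancelled.
  have J := VectorField.leibniz_identity_mlieBracket_apply (sm hV) (sm hW) (sm hZ)
  have J' := VectorField.leibniz_identity_mlieBracket_apply (sm hV) (sm hW) (sm (hZ.smul hf))
  have key : ∀ {V W : ∀ x : M, TangentSpace (𝓡 3) x}, SmoothField U V → SmoothField U W →
      VectorField.mlieBracket (𝓡 3) V
        (VectorField.mlieBracket (𝓡 3) W (fun y => f y • Z y)) x =
      dirDeriv V (dirDeriv W f) x • Z x + dirDeriv W f x • VectorField.mlieBracket (𝓡 3) V Z x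
      + dirDeriv V f x • VectorField.mlieBracket (𝓡 3) W Z x
      + f x • VectorField.mlieBracket (𝓡 3) V (VectorField.mlieBracket (𝓡 3) W Z) x := by
    intro V W hV hW
    have h1 : VectorField.mlieBracket (𝓡 3) W (fun y => f y • Z y) =ᶠ[𝓝 x]
        (fun y => dirDeriv W f y • Z y) + fun y => f y • VectorField.mlieBracket (𝓡 3) W Z y := by
      filter_upwards [hU.mem_nhds hx] with y hy
      exact mlieBracket_smul_right' (hf.mdiffAt hU hy) (hZ.mdiffAt hU hy)
    refine (Filter.EventuallyEq.mlieBracket_vectorField_eq Filter.EventuallyEq.rfl h1).trans ?_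
    rw [VectorField.mlieBracket_add_right]
    · rw [mlieBracket_smul_right' ((smoothFun_dirDeriv hU hf hW).mdiffAt hU hx) (hZ.mdiffAt hU hx),
        mlieBracket_smul_right' (hf.mdiffAt hU hx)
          ((smoothField_mlieBracket hU hW hZ).mdiffAt hU hx)]
      simp only [add_assoc]
    · exact (hZ.smul (smoothFun_dirDeriv hU hf hW)).mdiffAt hU hx
    · exact ((smoothField_mlieBracket hU hW hZ).smul hf).mdiffAt hU hx
  rw [key hV hW, key hW hV, mlieBracket_smul_right' (hf.mdiffAt hU hx) (hZ.mdiffAt hU hx), J] at J'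
  have h3 : (dirDeriv V (dirDeriv W f) x - dirDeriv W (dirDeriv V f) x -
      dirDeriv (VectorField.mlieBracket (𝓡 3) V W) f x) • Z x = 0 := by
    simp only [sub_smul, smul_add] at *
    rw [← sub_eq_zero] at J'
    rw [← J']
    abel
  rcases smul_eq_zero.1 h3 with h | h
  · linarith
  · exact absurd h hZx

end

/-! ### Moving frames -/

section
variable {g : LorentzMetric M} {e : Frame M} {U : Set M} {x : M} {f f' : M → ℝ}

lemma IsMovingFrame.smoothField (he : IsMovingFrame g e U) (a : Fin 3) : SmoothField U (e a) :=
  he.contMDiffOn a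

lemma IsMovingFrame.mem_nhds (he : IsMovingFrame g e U) (hx : x ∈ U) : U ∈ 𝓝 x :=
  he.isOpen.mem_nhds hx

lemma IsMovingFrame.mono {V : Set M} (he : IsMovingFrame g e U) (hV : IsOpen V) (h : V ⊆ U) :
    IsMovingFrame g e V :=
  ⟨hV, fun a => (he.contMDiffOn a).mono h, fun x hx => he.orthogonal x (h hx)⟩

/-- The components of the vector `v` relative to the frame `e`. -/
def frameCoord (g : LorentzMetric M) (e : Frame M) (x : M) (c : Fin 3)
    (v : TangentSpace (𝓡 3) x) : ℝ := ∑ d, etaInv c d * g.val x v (e d x)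

lemma IsMovingFrame.inner_sum (he : IsMovingFrame g e U) (hx : x ∈ U) (t : Fin 3 → ℝ)
    (d : Fin 3) : g.val x (∑ c, t c • e c x) (e d x) = ∑ c, t c * eta c d := by
  simp only [map_sum, map_smul, sum_apply, smul_apply,
    smul_eq_mul]
  exact Finset.sum_congr rfl fun c _ => by rw [he.orthogonal x hx]

lemma IsMovingFrame.frameCoord_sum (he : IsMovingFrame g e U) (hx : x ∈ U) (t : Fin 3 → ℝ)
    (c : Fin 3) : frameCoord g e x c (∑ b, t b • e b x) = t c := by
  simp only [frameCoord, he.inner_sum hx]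
  fin_cases c <;> (simp [Fin.sum_univ_three, eta, etaInv]; try ring)

lemma IsMovingFrame.linearIndependent (he : IsMovingFrame g e U) (hx : x ∈ U) :
    LinearIndependent ℝ (fun c => e c x) := by
  rw [Fintype.linearIndependent_iff]
  intro t ht c
  have := he.frameCoord_sum hx t c
  rw [ht] at this
  simpa [frameCoord] using this.symm

lemma IsMovingFrame.expand (he : IsMovingFrame g e U) (hx : x ∈ U) (v : TangentSpace (𝓡 3) x) :
    v = ∑ c, frameCoord g e x c v • e c x := by
  have hc : Fintype.card (Fin 3) = Module.finrank ℝ (TangentSpace (𝓡 3) x) := by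
    have : Module.finrank ℝ (EuclideanSpace ℝ (Fin 3)) = 3 := by simp
    rw [Fintype.card_fin]
    exact this.symm
  let B := basisOfLinearIndependentOfCardEqFinrank (he.linearIndependent hx) hc
  have hB : ∀ c, B c = e c x := fun c => by simp [B]
  have h := B.sum_repr v
  simp only [hB] at h
  have h2 : ∀ c, frameCoord g e x c v = B.repr v c := fun c => by
    conv_lhs => rw [← h]
    exact he.frameCoord_sum hx _ c
  simp only [h2, h]

lemma IsMovingFrame.ne_zero (he : IsMovingFrame g e U) (hx : x ∈ U) (a : Fin 3) : e a x ≠ 0 :=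
  (he.linearIndependent hx).ne_zero a

lemma IsMovingFrame.ext_coord (he : IsMovingFrame g e U) (hx : x ∈ U) {t t' : Fin 3 → ℝ}
    (h : ∑ c, t c • e c x = ∑ c, t' c • e c x) (c : Fin 3) : t c = t' c := by
  rw [← he.frameCoord_sum hx t c, h, he.frameCoord_sum hx]

lemma IsMovingFrame.mlieBracket_eq (he : IsMovingFrame g e U) (hx : x ∈ U) (a b : Fin 3) :
    VectorField.mlieBracket (𝓡 3) (e a) (e b) x = ∑ c, struct g e c a b x • e c x :=
  he.expand hx _

lemma structLow_swap (g : LorentzMetric M) (e : Frame M) (a b c : Fin 3) (x : M) :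
    structLow g e b a c x = - structLow g e a b c x := by
  simp only [structLow]
  rw [VectorField.mlieBracket_swap_apply]
  simp

/-- Metric compatibility, for a frame whose inner products are constant. -/
lemma connLow_swap (g : LorentzMetric M) (e : Frame M) (a b c : Fin 3) (x : M) :
    connLow g e a c b x = - connLow g e a b c x := by
  simp only [connLow]
  rw [structLow_swap g e b c a]
  ring

lemma connLow_self (g : LorentzMetric M) (e : Frame M) (a b : Fin 3) (x : M) :
    connLow g e a b b x = 0 := by
  have := connLow_swap g e a b b x
  linarith

/-- Vanishing torsion, in lowered form. -/
lemma connLow_sub (g : LorentzMetric M) (e : Frame M) (a b c : Fin 3) (x : M) :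
    connLow g e a b c x - connLow g e b a c x = structLow g e a b c x := by
  simp only [connLow]
  rw [structLow_swap g e a b c]
  ring

lemma conn_torsion (g : LorentzMetric M) (e : Frame M) (a b c : Fin 3) (x : M) :
    struct g e c a b x = conn g e c a b x - conn g e c b a x := by
  simp only [struct, conn, ← Finset.sum_sub_distrib, ← mul_sub, connLow_sub]

/-- Skewness leaves three free components in each direction `a`: Γ⁰_{a0}, Γ¹_{a0} and Γ⁰_{a1}. This
and the next five lemmas eliminate the other six. -/
lemma conn_two_zero (g : LorentzMetric M) (e : Frame M) (a : Fin 3) :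
    conn g e 2 a 0 = fun _ => 0 := by
  ext x; simp [conn, Fin.sum_univ_three, etaInv, connLow_self]

lemma conn_one_one (g : LorentzMetric M) (e : Frame M) (a : Fin 3) :
    conn g e 1 a 1 = fun _ => 0 := by
  ext x; simp [conn, Fin.sum_univ_three, etaInv, connLow_self]

lemma conn_zero_two (g : LorentzMetric M) (e : Frame M) (a : Fin 3) :
    conn g e 0 a 2 = fun _ => 0 := by
  ext x; simp [conn, Fin.sum_univ_three, etaInv, connLow_self]

lemma conn_two_one (g : LorentzMetric M) (e : Frame M) (a : Fin 3) :
    conn g e 2 a 1 = fun x => 1 / 2 * conn g e 1 a 0 x := by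
  ext x; simp [conn, Fin.sum_univ_three, etaInv, connLow_swap g e a 0 1]

lemma conn_one_two (g : LorentzMetric M) (e : Frame M) (a : Fin 3) :
    conn g e 1 a 2 = fun x => 2 * conn g e 0 a 1 x := by
  ext x; simp [conn, Fin.sum_univ_three, etaInv, connLow_swap g e a 1 2]

lemma conn_two_two (g : LorentzMetric M) (e : Frame M) (a : Fin 3) :
    conn g e 2 a 2 = fun x => - conn g e 0 a 0 x := by
  ext x; simp [conn, Fin.sum_univ_three, etaInv, connLow_swap g e a 0 2]

/-- The components of the connection are skew-symmetric with respect to `η`. -/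
lemma conn_skew (g : LorentzMetric M) (e : Frame M) (a b c : Fin 3) (x : M) :
    ∑ d, (eta c d * conn g e d a b x + eta b d * conn g e d a c x) = 0 := by
  fin_cases b <;> fin_cases c <;>
    simp [Fin.sum_univ_three, eta, conn_two_zero, conn_one_one, conn_zero_two, conn_two_one,
      conn_one_two, conn_two_two]

/-! #### Smoothness -/

lemma SmoothFun.sum {ι : Type*} {s : Finset ι} {F : ι → M → ℝ}
    (hF : ∀ i ∈ s, SmoothFun U (F i)) : SmoothFun U (fun x => ∑ i ∈ s, F i x) :=
  contMDiffOn_finsetSum hF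

lemma SmoothFun.mul (hf : SmoothFun U f) (hf' : SmoothFun U f') :
    SmoothFun U (fun x => f x * f' x) := ContMDiffOn.mul hf hf'

lemma SmoothFun.add (hf : SmoothFun U f) (hf' : SmoothFun U f') :
    SmoothFun U (fun x => f x + f' x) := ContMDiffOn.add hf hf'

lemma SmoothFun.sub (hf : SmoothFun U f) (hf' : SmoothFun U f') :
    SmoothFun U (fun x => f x - f' x) := ContMDiffOn.sub hf hf'

lemma SmoothFun.const (c : ℝ) : SmoothFun U (fun _ : M => c) := contMDiffOn_const

lemma IsMovingFrame.smooth_frameDeriv (he : IsMovingFrame g e U) (hf : SmoothFun U f)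
    (a : Fin 3) : SmoothFun U (frameDeriv e a f) :=
  smoothFun_dirDeriv he.isOpen hf (he.smoothField a)

lemma IsMovingFrame.smooth_structLow (he : IsMovingFrame g e U) (a b c : Fin 3) :
    SmoothFun U (structLow g e a b c) :=
  smoothFun_inner g (smoothField_mlieBracket he.isOpen (he.smoothField a) (he.smoothField b))
    (he.smoothField c)

lemma IsMovingFrame.smooth_struct (he : IsMovingFrame g e U) (a b c : Fin 3) :
    SmoothFun U (struct g e a b c) :=
  SmoothFun.sum fun _ _ => (SmoothFun.const _).mul (he.smooth_structLow _ _ _)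

lemma IsMovingFrame.smooth_conn (he : IsMovingFrame g e U) (a b c : Fin 3) :
    SmoothFun U (conn g e a b c) := by
  refine SmoothFun.sum fun d _ => (SmoothFun.const _).mul ?_
  have h := (SmoothFun.const (1 / 2)).mul (((he.smooth_structLow b c d).sub
    (he.smooth_structLow b d c)).sub (he.smooth_structLow c d b))
  exact h.congr fun y _ => by simp only [connLow]; ring

lemma IsMovingFrame.smooth_riemUp (he : IsMovingFrame g e U) (a b c d : Fin 3) :
    SmoothFun U (riemUp g e a b c d) := by
  refine SmoothFun.add ((he.smooth_frameDeriv (he.smooth_conn _ _ _) _).sub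
    (he.smooth_frameDeriv (he.smooth_conn _ _ _) _)) (SmoothFun.sum fun f _ => ?_)
  exact (((he.smooth_conn _ _ _).mul (he.smooth_conn _ _ _)).sub
    ((he.smooth_conn _ _ _).mul (he.smooth_conn _ _ _))).sub
    ((he.smooth_struct _ _ _).mul (he.smooth_conn _ _ _))

lemma IsMovingFrame.smooth_riem (he : IsMovingFrame g e U) (a b c d : Fin 3) :
    SmoothFun U (riem g e a b c d) :=
  SmoothFun.sum fun _ _ => (SmoothFun.const _).mul (he.smooth_riemUp _ _ _ _)

lemma IsMovingFrame.smooth_covDeriv (he : IsMovingFrame g e U) {k : ℕ}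
    {T : (Fin k → Fin 3) → M → ℝ} (hT : ∀ a, SmoothFun U (T a)) (a : Fin (k + 1) → Fin 3) :
    SmoothFun U (covDeriv g e T a) := by
  refine (he.smooth_frameDeriv (hT _) _).sub (SmoothFun.sum fun i _ => SmoothFun.sum fun b _ => ?_)
  exact (he.smooth_conn _ _ _).mul (hT _)

lemma IsMovingFrame.smooth_curvComp (he : IsMovingFrame g e U) :
    ∀ (k : ℕ) (a : Fin (4 + k) → Fin 3), SmoothFun U (curvComp g e k a)
  | 0, _ => he.smooth_riem _ _ _ _
  | k + 1, a => he.smooth_covDeriv (he.smooth_curvComp k) a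

/-! #### Commutators and the Jacobi identity -/

lemma IsMovingFrame.frameDeriv_congr (he : IsMovingFrame g e U) (hx : x ∈ U)
    (h : ∀ y ∈ U, f y = f' y) (a : Fin 3) : frameDeriv e a f x = frameDeriv e a f' x :=
  dirDeriv_congr (Filter.eventually_of_mem (he.mem_nhds hx) h)

lemma dirDeriv_sum_smul (t : Fin 3 → ℝ) (e : Frame M) (V : ∀ x : M, TangentSpace (𝓡 3) x)
    (hV : V x = ∑ c, t c • e c x) :
    dirDeriv V f x = ∑ c, t c * frameDeriv e c f x := by
  simp only [dirDeriv, hV, map_sum, map_smul, frameDeriv]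
  rfl

lemma IsMovingFrame.frameDeriv_comm (he : IsMovingFrame g e U) (hx : x ∈ U)
    (hf : SmoothFun U f) (a b : Fin 3) :
    frameDeriv e a (frameDeriv e b f) x - frameDeriv e b (frameDeriv e a f) x =
      ∑ c, struct g e c a b x * frameDeriv e c f x := by
  have h := dirDeriv_comm he.isOpen hx (he.smoothField a) (he.smoothField b) (he.smoothField 0)
    (he.ne_zero hx 0) hf
  rw [dirDeriv_sum_smul (fun c => struct g e c a b x) e _ (he.mlieBracket_eq hx a b)] at h
  exact h

lemma IsMovingFrame.mlieBracket_mlieBracket (he : IsMovingFrame g e U) (hx : x ∈ U)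
    (a b c : Fin 3) :
    VectorField.mlieBracket (𝓡 3) (e a) (VectorField.mlieBracket (𝓡 3) (e b) (e c)) x =
      ∑ d, (frameDeriv e a (struct g e d b c) x +
        ∑ f, struct g e f b c x * struct g e d a f x) • e d x := by
  have h1 : VectorField.mlieBracket (𝓡 3) (e a) (VectorField.mlieBracket (𝓡 3) (e b) (e c)) x =
      VectorField.mlieBracket (𝓡 3) (e a) (fun y => ∑ d, struct g e d b c y • e d y) x := by
    refine Filter.EventuallyEq.mlieBracket_vectorField_eq Filter.EventuallyEq.rfl ?_
    filter_upwards [he.mem_nhds hx] with y hy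
    exact he.mlieBracket_eq hy b c
  rw [h1, mlieBracket_sum_right _ he.isOpen hx
    (fun d _ => (he.smoothField d).smul (he.smooth_struct d b c))]
  have h2 : ∀ d, VectorField.mlieBracket (𝓡 3) (e a) (fun y => struct g e d b c y • e d y) x =
      frameDeriv e a (struct g e d b c) x • e d x +
        struct g e d b c x • ∑ f, struct g e f a d x • e f x := by
    intro d
    rw [mlieBracket_smul_right' ((he.smooth_struct d b c).mdiffAt he.isOpen hx)
      ((he.smoothField d).mdiffAt he.isOpen hx), he.mlieBracket_eq hx]
    rfl
  simp only [h2, Finset.sum_add_distrib, add_smul, Finset.smul_sum, Finset.sum_smul, smul_smul]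
  congr 1
  exact Finset.sum_comm

lemma IsMovingFrame.jacobi (he : IsMovingFrame g e U) (hx : x ∈ U) (a b c d : Fin 3) :
    (frameDeriv e a (struct g e d b c) x + ∑ f, struct g e f b c x * struct g e d a f x) +
    (frameDeriv e b (struct g e d c a) x + ∑ f, struct g e f c a x * struct g e d b f x) +
    (frameDeriv e c (struct g e d a b) x + ∑ f, struct g e f a b x * struct g e d c f x) = 0 := by
  haveI : IsManifold (𝓡 3) (minSmoothness ℝ 3) M :=
    .of_le (n := ∞) (by simpa using three_le_smooth)
  have sm : ∀ a, ContMDiffAt (𝓡 3) (𝓡 3).tangent (minSmoothness ℝ 2)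
        (fun x => (⟨x, e a x⟩ : TangentBundle (𝓡 3) M)) x := fun a =>
    ((he.smoothField a).contMDiffAt (he.mem_nhds hx)).of_le (by simpa using two_le_smooth)
  have J := VectorField.leibniz_identity_mlieBracket_apply (sm a) (sm b) (sm c)
  -- Two swaps turn the Leibniz form of the Jacobi identity into the cyclic one.
  rw [VectorField.mlieBracket_swap_apply (V := VectorField.mlieBracket (𝓡 3) (e a) (e b)),
    VectorField.mlieBracket_swap (V := e a) (W := e c)] at J
  have h3 : VectorField.mlieBracket (𝓡 3) (e b) (-VectorField.mlieBracket (𝓡 3) (e c) (e a)) x =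
      - VectorField.mlieBracket (𝓡 3) (e b) (VectorField.mlieBracket (𝓡 3) (e c) (e a)) x := by
    have := mlieBracket_smul_right' (V := e b) (f := fun _ => (-1 : ℝ)) (x := x)
      mdifferentiableAt_const ((smoothField_mlieBracket he.isOpen (he.smoothField c)
        (he.smoothField a)).mdiffAt he.isOpen hx)
    rw [dirDeriv_const, zero_smul, zero_add, neg_one_smul] at this
    rw [← this]
    congr 1
    ext y
    simp
  rw [h3] at J
  simp only [he.mlieBracket_mlieBracket hx, ← Finset.sum_neg_distrib, ← Finset.sum_add_distrib,
    ← neg_smul, ← add_smul] at J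
  have := he.ext_coord hx J d
  linarith

end

/-! ### Change of moving frame -/

/-- The derivative of a matrix-valued function along the frame vector `e_a`. -/
def matDeriv (e : Frame M) (a : Fin 3) (F : M → Matrix (Fin 3) (Fin 3) ℝ) (x : M) :
    Matrix (Fin 3) (Fin 3) ℝ := Matrix.of fun i j => frameDeriv e a (fun y => F y i j) x

/-- `F` is a smooth matrix-valued function on `U`. -/
def SmoothMat (U : Set M) (F : M → Matrix (Fin 3) (Fin 3) ℝ) : Prop :=
  ∀ i j, SmoothFun U (fun y => F y i j)

/-- The connection matrices `(Γ_a)^c_b = Γ^c_{ab}`. -/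
def connMat (g : LorentzMetric M) (e : Frame M) (a : Fin 3) (x : M) :
    Matrix (Fin 3) (Fin 3) ℝ := Matrix.of fun c b => conn g e c a b x

/-- The curvature matrices `(R_{cd})^a_b = R^a_{bcd}`. -/
def curvMat (g : LorentzMetric M) (e : Frame M) (c d : Fin 3) (x : M) :
    Matrix (Fin 3) (Fin 3) ℝ := Matrix.of fun a b => riemUp g e a b c d x

/-- The matrix `X` with `e'_a = X^b_a e_b`. -/
def changeMat (g : LorentzMetric M) (e e' : Frame M) (x : M) : Matrix (Fin 3) (Fin 3) ℝ :=
  Matrix.of fun b a => frameCoord g e x b (e' a x)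

section
variable {g : LorentzMetric M} {e e' : Frame M} {U : Set M} {x : M} {f f' : M → ℝ}
  {F F' : M → Matrix (Fin 3) (Fin 3) ℝ}

lemma SmoothMat.mul (hF : SmoothMat U F) (hF' : SmoothMat U F') :
    SmoothMat U (fun y => F y * F' y) := fun i j =>
  (SmoothFun.sum fun k _ => (hF i k).mul (hF' k j)).congr fun _ _ => Matrix.mul_apply

lemma IsMovingFrame.frameDeriv_add (he : IsMovingFrame g e U) (hx : x ∈ U) (hf : SmoothFun U f)
    (hf' : SmoothFun U f') (a : Fin 3) :
    frameDeriv e a (fun y => f y + f' y) x = frameDeriv e a f x + frameDeriv e a f' x :=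
  dirDeriv_add (hf.mdiffAt he.isOpen hx) (hf'.mdiffAt he.isOpen hx)

lemma IsMovingFrame.frameDeriv_sub (he : IsMovingFrame g e U) (hx : x ∈ U) (hf : SmoothFun U f)
    (hf' : SmoothFun U f') (a : Fin 3) :
    frameDeriv e a (fun y => f y - f' y) x = frameDeriv e a f x - frameDeriv e a f' x :=
  dirDeriv_sub (hf.mdiffAt he.isOpen hx) (hf'.mdiffAt he.isOpen hx)

lemma IsMovingFrame.frameDeriv_mul (he : IsMovingFrame g e U) (hx : x ∈ U) (hf : SmoothFun U f)
    (hf' : SmoothFun U f') (a : Fin 3) :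
    frameDeriv e a (fun y => f y * f' y) x =
      f x * frameDeriv e a f' x + f' x * frameDeriv e a f x :=
  dirDeriv_mul (hf.mdiffAt he.isOpen hx) (hf'.mdiffAt he.isOpen hx)

lemma IsMovingFrame.frameDeriv_const_mul (he : IsMovingFrame g e U) (hx : x ∈ U)
    (hf : SmoothFun U f) (c : ℝ) (a : Fin 3) :
    frameDeriv e a (fun y => c * f y) x = c * frameDeriv e a f x :=
  dirDeriv_const_mul c (hf.mdiffAt he.isOpen hx)

lemma frameDeriv_const (e : Frame M) (c : ℝ) (a : Fin 3) (x : M) :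
    frameDeriv e a (fun _ => c) x = 0 := dirDeriv_const c

lemma frameDeriv_neg (e : Frame M) (a : Fin 3) (x : M) :
    frameDeriv e a (fun y => - f y) x = - frameDeriv e a f x := dirDeriv_neg

lemma IsMovingFrame.frameDeriv_sum (he : IsMovingFrame g e U) (hx : x ∈ U) {ι : Type*}
    {s : Finset ι} {F : ι → M → ℝ} (hF : ∀ i ∈ s, SmoothFun U (F i)) (a : Fin 3) :
    frameDeriv e a (fun y => ∑ i ∈ s, F i y) x = ∑ i ∈ s, frameDeriv e a (F i) x :=
  dirDeriv_sum s fun i hi => (hF i hi).mdiffAt he.isOpen hx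

lemma IsMovingFrame.matDeriv_mul (he : IsMovingFrame g e U) (hx : x ∈ U) (hF : SmoothMat U F)
    (hF' : SmoothMat U F') (a : Fin 3) :
    matDeriv e a (fun y => F y * F' y) x = matDeriv e a F x * F' x + F x * matDeriv e a F' x := by
  ext i j
  simp only [matDeriv, Matrix.of_apply, Matrix.add_apply, Matrix.mul_apply]
  rw [he.frameDeriv_sum hx (fun k _ => (hF i k).mul (hF' k j)), ← Finset.sum_add_distrib]
  exact Finset.sum_congr rfl fun k _ => by rw [he.frameDeriv_mul hx (hF i k) (hF' k j)]; ring

lemma IsMovingFrame.matDeriv_add (he : IsMovingFrame g e U) (hx : x ∈ U) (hF : SmoothMat U F)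
    (hF' : SmoothMat U F') (a : Fin 3) :
    matDeriv e a (fun y => F y + F' y) x = matDeriv e a F x + matDeriv e a F' x := by
  ext i j
  exact he.frameDeriv_add hx (hF i j) (hF' i j) a

lemma IsMovingFrame.matDeriv_congr (he : IsMovingFrame g e U) (hx : x ∈ U)
    (h : ∀ y ∈ U, F y = F' y) (a : Fin 3) : matDeriv e a F x = matDeriv e a F' x := by
  ext i j
  exact he.frameDeriv_congr hx (fun y hy => by rw [h y hy]) a

lemma IsMovingFrame.smoothMat_conn (he : IsMovingFrame g e U) (a : Fin 3) :
    SmoothMat U (connMat g e a) := fun _ _ => he.smooth_conn _ _ _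

lemma IsMovingFrame.smoothMat_matDeriv (he : IsMovingFrame g e U) (hF : SmoothMat U F)
    (a : Fin 3) : SmoothMat U (matDeriv e a F) := fun i j => he.smooth_frameDeriv (hF i j) a

lemma curvMat_eq (g : LorentzMetric M) (e : Frame M) (c d : Fin 3) (x : M) :
    curvMat g e c d x = matDeriv e c (connMat g e d) x - matDeriv e d (connMat g e c) x
      + (connMat g e c x * connMat g e d x - connMat g e d x * connMat g e c x)
      - ∑ f, struct g e f c d x • connMat g e f x := by
  ext a b
  simp only [curvMat, riemUp, matDeriv, connMat, Matrix.of_apply, Matrix.add_apply,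
    Matrix.sub_apply, Matrix.mul_apply, Matrix.sum_apply, Matrix.smul_apply, smul_eq_mul,
    Finset.sum_sub_distrib]
  ring

lemma IsMovingFrame.smoothMat_change (he : IsMovingFrame g e U) (he' : IsMovingFrame g e' U) :
    SmoothMat U (changeMat g e e') := fun b a =>
  SmoothFun.sum (s := Finset.univ) (F := fun d x => etaInv b d * g.val x (e' a x) (e d x)) fun d _ =>
    (SmoothFun.const _).mul (smoothFun_inner g (he'.smoothField a) (he.smoothField d))

lemma IsMovingFrame.eq_sum_change (he : IsMovingFrame g e U) (hx : x ∈ U) (a : Fin 3) :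
    e' a x = ∑ b, changeMat g e e' x b a • e b x := he.expand hx _

lemma changeMat_orth (he : IsMovingFrame g e U) (he' : IsMovingFrame g e' U) (hx : x ∈ U) :
    (changeMat g e e' x)ᵀ * eta * changeMat g e e' x = eta := by
  ext a b
  rw [← he'.orthogonal x hx a b]
  conv_rhs => rw [he.eq_sum_change (e' := e') hx b]
  rw [map_sum, Matrix.mul_apply]
  refine Finset.sum_congr rfl fun c _ => ?_
  rw [map_smul, he.eq_sum_change (e' := e') hx a, he.inner_sum hx, Matrix.mul_apply]
  simp only [Matrix.transpose_apply, smul_eq_mul]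
  ring

/-- The left inverse η⁻¹ Xᵀ η of `X` is also its right inverse. -/
lemma etaInv_of_orth {X : Matrix (Fin 3) (Fin 3) ℝ} (h : Xᵀ * eta * X = eta) :
    X * etaInv * Xᵀ = etaInv := by
  have h1 : (etaInv * Xᵀ * eta) * X = 1 := by
    rw [Matrix.mul_assoc, Matrix.mul_assoc, ← Matrix.mul_assoc Xᵀ, h]
    exact mul_eq_one_comm.1 eta_mul_etaInv
  have h2 := mul_eq_one_comm.1 h1
  calc X * etaInv * Xᵀ = (X * (etaInv * Xᵀ * eta)) * etaInv := by
        simp only [Matrix.mul_assoc, eta_mul_etaInv, Matrix.mul_one]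
    _ = etaInv := by rw [h2, Matrix.one_mul]

/-- The matrix of the frame derivative along `e'_a = X^b_a e_b`. -/
lemma IsMovingFrame.frameDeriv_change (he : IsMovingFrame g e U) (hx : x ∈ U) (a : Fin 3) :
    frameDeriv e' a f x = ∑ b, changeMat g e e' x b a * frameDeriv e b f x :=
  dirDeriv_sum_smul _ e _ (he.eq_sum_change hx a)

/-- The right-hand side of the transformation law of connection matrices. -/
def connChange (g : LorentzMetric M) (e e' : Frame M) (a : Fin 3) (x : M) :
    Matrix (Fin 3) (Fin 3) ℝ :=
  matDeriv e' a (changeMat g e e') x +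
    (∑ h, changeMat g e e' x h a • connMat g e h x) * changeMat g e e' x

lemma connChange_apply (a f b : Fin 3) : connChange g e e' a x f b =
    frameDeriv e' a (fun y => changeMat g e e' y f b) x +
      ∑ d, ∑ h, changeMat g e e' x d a * changeMat g e e' x h b * conn g e f d h x := by
  simp only [connChange, matDeriv, connMat, Matrix.add_apply, Matrix.mul_apply, Matrix.sum_apply,
    Matrix.smul_apply, Matrix.of_apply, smul_eq_mul, Finset.sum_mul]
  congr 1
  exact Finset.sum_congr rfl fun _ _ => Finset.sum_congr rfl fun _ _ => by ring

lemma mlieBracket_change (he : IsMovingFrame g e U) (he' : IsMovingFrame g e' U) (hx : x ∈ U)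
    (a b : Fin 3) :
    VectorField.mlieBracket (𝓡 3) (e' a) (e' b) x =
      ∑ f, (connChange g e e' a x f b - connChange g e e' b x f a) • e f x := by
  have hX := he.smoothMat_change he'
  have h1 : ∀ V : ∀ x : M, TangentSpace (𝓡 3) x, ∀ b,
      VectorField.mlieBracket (𝓡 3) V (e' b) x =
      ∑ f, (dirDeriv V (fun y => changeMat g e e' y f b) x • e f x +
        changeMat g e e' x f b • VectorField.mlieBracket (𝓡 3) V (e f) x) := by
    intro V b
    have h : VectorField.mlieBracket (𝓡 3) V (e' b) x =
        VectorField.mlieBracket (𝓡 3) V (fun y => ∑ f, changeMat g e e' y f b • e f y) x := by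
      refine Filter.EventuallyEq.mlieBracket_vectorField_eq Filter.EventuallyEq.rfl ?_
      filter_upwards [he.mem_nhds hx] with y hy
      exact he.eq_sum_change hy b
    rw [h, mlieBracket_sum_right _ he.isOpen hx (fun f _ => (he.smoothField f).smul (hX f b))]
    exact Finset.sum_congr rfl fun f _ => mlieBracket_smul_right'
      ((hX f b).mdiffAt he.isOpen hx) ((he.smoothField f).mdiffAt he.isOpen hx)
  rw [h1]
  have h2 : ∀ f, VectorField.mlieBracket (𝓡 3) (e' a) (e f) x =
      ∑ d, (- frameDeriv e f (fun y => changeMat g e e' y d a) x +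
        ∑ h, changeMat g e e' x h a * struct g e d h f x) • e d x := by
    intro f
    rw [VectorField.mlieBracket_swap_apply, h1, ← Finset.sum_neg_distrib]
    simp only [add_smul, Finset.sum_add_distrib, neg_add, neg_smul]
    congr 1
    simp only [he.mlieBracket_eq hx, Finset.smul_sum, Finset.sum_smul, smul_smul,
      ← Finset.sum_neg_distrib, ← neg_smul]
    rw [Finset.sum_comm]
    refine Finset.sum_congr rfl fun d _ => Finset.sum_congr rfl fun h _ => ?_
    congr 1
    rw [conn_torsion g e f h, conn_torsion g e h f]; ring
  simp only [h2, Finset.smul_sum, smul_smul, Finset.sum_add_distrib]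
  rw [Finset.sum_comm, ← Finset.sum_add_distrib]
  refine Finset.sum_congr rfl fun d _ => ?_
  rw [← Finset.sum_smul, ← add_smul]
  congr 1
  rw [connChange_apply, connChange_apply, he.frameDeriv_change (e' := e') hx b]
  simp only [frameDeriv_eq_dirDeriv, conn_torsion, mul_add, Finset.mul_sum, Finset.sum_add_distrib]
  simp only [Fin.sum_univ_three]
  ring

/-- Differentiating Xᵀ η X = η handles the derivative term of `connChange`; `conn_skew` handles the
other. -/
lemma connChange_skew (he : IsMovingFrame g e U) (he' : IsMovingFrame g e' U) (hx : x ∈ U)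
    (a b c : Fin 3) :
    ∑ f, ∑ k, eta f k * (connChange g e e' a x f b * changeMat g e e' x k c +
      connChange g e e' a x f c * changeMat g e e' x k b) = 0 := by
  have hX := he.smoothMat_change he'
  have h0 : frameDeriv e' a (fun y => ∑ f, ∑ k, eta f k *
      (changeMat g e e' y f b * changeMat g e e' y k c)) x = 0 := by
    rw [← frameDeriv_const e' (eta b c) a x]
    refine he'.frameDeriv_congr hx (fun y hy => ?_) a
    refine Eq.trans ?_ (congrFun₂ (changeMat_orth he he' hy) b c)
    simp only [Matrix.mul_apply, Matrix.transpose_apply, Finset.sum_mul]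
    rw [Finset.sum_comm]
    exact Finset.sum_congr rfl fun _ _ => Finset.sum_congr rfl fun _ _ => by ring
  rw [he'.frameDeriv_sum hx (F := fun f y => ∑ k, eta f k *
      (changeMat g e e' y f b * changeMat g e e' y k c)) (fun f _ => SmoothFun.sum fun k _ =>
    (SmoothFun.const _).mul ((hX f b).mul (hX k c)))] at h0
  have h1 : ∀ f, frameDeriv e' a (fun y => ∑ k, eta f k *
      (changeMat g e e' y f b * changeMat g e e' y k c)) x = ∑ k, eta f k *
      (changeMat g e e' x f b * frameDeriv e' a (fun y => changeMat g e e' y k c) x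
        + changeMat g e e' x k c * frameDeriv e' a (fun y => changeMat g e e' y f b) x) := by
    intro f
    rw [he'.frameDeriv_sum hx (fun k _ => (SmoothFun.const _).mul ((hX f b).mul (hX k c)))]
    refine Finset.sum_congr rfl fun k _ => ?_
    rw [he'.frameDeriv_const_mul hx ((hX f b).mul (hX k c)),
      he'.frameDeriv_mul hx (hX f b) (hX k c)]
  simp only [h1] at h0
  simp only [connChange_apply]
  have h2 : ∀ d, ∑ h, ∑ k, changeMat g e e' x h b * changeMat g e e' x k c *
      ∑ f, (eta k f * conn g e f d h x + eta h f * conn g e f d k x) = 0 := fun d =>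
    Finset.sum_eq_zero fun h _ => Finset.sum_eq_zero fun k _ => by
      rw [conn_skew g e d h k x, mul_zero]
  have h20 := h2 0
  have h21 := h2 1
  have h22 := h2 2
  simp only [Fin.sum_univ_three, eta, Matrix.of_apply, Matrix.cons_val', Matrix.cons_val_zero,
    Matrix.cons_val_one, Matrix.cons_val, Matrix.empty_val', Matrix.cons_val_fin_one] at *
  linear_combination h0 + changeMat g e e' x 0 a * h20 + changeMat g e e' x 1 a * h21 +
    changeMat g e e' x 2 a * h22

/-- The right-hand side is skew in `b, c` and its antisymmetrization in `a, b` is the structure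
function of `e'`. The Koszul formula recovers any such array. -/
lemma connLow_change (he : IsMovingFrame g e U) (he' : IsMovingFrame g e' U) (hx : x ∈ U)
    (a b c : Fin 3) :
    connLow g e' a b c x =
      ∑ f, ∑ k, eta f k * (connChange g e e' a x f b * changeMat g e e' x k c) := by
  have hS : ∀ a b c, structLow g e' a b c x = ∑ f, ∑ k, eta f k *
      ((connChange g e e' a x f b - connChange g e e' b x f a) * changeMat g e e' x k c) := by
    intro a b c
    rw [structLow, mlieBracket_change he he' hx, he.eq_sum_change (e' := e') hx c, map_sum,
      Finset.sum_comm]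
    refine Finset.sum_congr rfl fun k _ => ?_
    rw [map_smul, he.inner_sum hx, smul_eq_mul, Finset.mul_sum]
    exact Finset.sum_congr rfl fun f _ => by ring
  have h1 := connChange_skew he he' hx a b c
  have h2 := connChange_skew he he' hx b a c
  have h3 := connChange_skew he he' hx c a b
  simp only [connLow, hS, mul_add, mul_sub, sub_mul, Finset.sum_add_distrib,
    Finset.sum_sub_distrib] at *
  linarith

/-- The transformation law of the connection matrices. -/
lemma connMat_change (he : IsMovingFrame g e U) (he' : IsMovingFrame g e' U) (hx : x ∈ U)
    (a : Fin 3) : changeMat g e e' x * connMat g e' a x = connChange g e e' a x := by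
  have h : connMat g e' a x =
      etaInv * (changeMat g e e' x)ᵀ * eta * connChange g e e' a x := by
    ext c b
    simp only [connMat, Matrix.of_apply, conn, Matrix.mul_assoc]
    rw [Matrix.mul_apply]
    refine Finset.sum_congr rfl fun d _ => ?_
    rw [connLow_change he he' hx, Matrix.mul_apply, Finset.sum_comm]
    congr 1
    refine Finset.sum_congr rfl fun k _ => ?_
    rw [Matrix.mul_apply, Finset.mul_sum]
    refine Finset.sum_congr rfl fun f _ => ?_
    have s : eta f k = eta k f := by fin_cases f <;> fin_cases k <;> rfl
    rw [s, Matrix.transpose_apply]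
    ring
  have h2 := etaInv_of_orth (changeMat_orth he he' hx)
  calc _ = (changeMat g e e' x * etaInv * (changeMat g e e' x)ᵀ) * eta * connChange g e e' a x := by
        rw [h]; simp only [Matrix.mul_assoc]
    _ = _ := by
        rw [h2, mul_eq_one_comm.1 eta_mul_etaInv, Matrix.one_mul]

end

/-! ### Transformation of the curvature under a change of frame. -/

section
variable {g : LorentzMetric M} {e e' : Frame M} {U : Set M} {x : M} {f f' : M → ℝ}
  {F F' : M → Matrix (Fin 3) (Fin 3) ℝ}

lemma IsMovingFrame.matDeriv_comm (he : IsMovingFrame g e U) (hx : x ∈ U) (hF : SmoothMat U F)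
    (a b : Fin 3) :
    matDeriv e a (matDeriv e b F) x - matDeriv e b (matDeriv e a F) x =
      ∑ c, struct g e c a b x • matDeriv e c F x := by
  ext i j
  simp only [Matrix.sum_apply, Matrix.sub_apply, Matrix.smul_apply, smul_eq_mul]
  exact he.frameDeriv_comm hx (hF i j) a b

/-- The connection of `e` along the vectors of `e'`. -/
def pullConn (g : LorentzMetric M) (e e' : Frame M) (a : Fin 3) (x : M) :
    Matrix (Fin 3) (Fin 3) ℝ := ∑ h, changeMat g e e' x h a • connMat g e h x

lemma smoothMat_pullConn (he : IsMovingFrame g e U) (he' : IsMovingFrame g e' U) (a : Fin 3) :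
    SmoothMat U (pullConn g e e' a) := fun i j => by
  have : SmoothFun U fun y => ∑ h, changeMat g e e' y h a * connMat g e h y i j :=
    SmoothFun.sum fun h _ => ((he.smoothMat_change he') h a).mul (he.smoothMat_conn h i j)
  refine this.congr fun y _ => ?_
  simp [pullConn, Matrix.sum_apply]

lemma matDeriv_pullConn (he : IsMovingFrame g e U) (he' : IsMovingFrame g e' U) (hx : x ∈ U)
    (c d : Fin 3) : matDeriv e' c (pullConn g e e' d) x =
      ∑ h, (matDeriv e' c (changeMat g e e') x h d • connMat g e h x +
        changeMat g e e' x h d • ∑ k, changeMat g e e' x k c • matDeriv e k (connMat g e h) x) := by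
  ext i j
  have h1 : frameDeriv e' c (fun y => pullConn g e e' d y i j) x =
      frameDeriv e' c (fun y => ∑ h, changeMat g e e' y h d * conn g e i h j y) x :=
    he'.frameDeriv_congr hx (fun y _ => by simp [pullConn, Matrix.sum_apply, connMat]) c
  have hs := he.smoothMat_change he'
  simp only [matDeriv, Matrix.of_apply, h1]
  rw [he'.frameDeriv_sum hx (fun h _ => (hs h d).mul (he.smooth_conn i h j))]
  simp only [Matrix.sum_apply, Matrix.add_apply, Matrix.smul_apply, smul_eq_mul, Matrix.of_apply]
  refine Finset.sum_congr rfl fun h _ => ?_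
  rw [he'.frameDeriv_mul hx (hs h d) (he.smooth_conn i h j), he.frameDeriv_change hx c]
  simp only [connMat, Matrix.of_apply]
  ring

lemma struct_change (he : IsMovingFrame g e U) (he' : IsMovingFrame g e' U) (hx : x ∈ U)
    (c d h : Fin 3) :
    ∑ f, struct g e' f c d x * changeMat g e e' x h f =
      connChange g e e' c x h d - connChange g e e' d x h c := by
  rw [← connMat_change he he' hx, ← connMat_change he he' hx, Matrix.mul_apply, Matrix.mul_apply,
    ← Finset.sum_sub_distrib]
  refine Finset.sum_congr rfl fun f _ => ?_
  rw [conn_torsion]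
  simp only [connMat, Matrix.of_apply]
  ring

/-- The transformation law of the curvature matrices. -/
lemma curvMat_change (he : IsMovingFrame g e U) (he' : IsMovingFrame g e' U) (hx : x ∈ U)
    (c d : Fin 3) : changeMat g e e' x * curvMat g e' c d x =
      (∑ k, ∑ h, (changeMat g e e' x k c * changeMat g e e' x h d) • curvMat g e k h x) *
        changeMat g e e' x := by
  have hs := he.smoothMat_change he'
  -- This is the law X Γ'_d = ∂_d X + P_d X of `connMat_change`, differentiated along e'_c, with P =
  -- `pullConn`. Antisymmetrizing in `c, d` leaves second derivatives of X only through a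
  -- commutator, which `hcomm` replaces by first derivatives.
  have key : ∀ c d, matDeriv e' c (changeMat g e e') x * connMat g e' d x +
      changeMat g e e' x * matDeriv e' c (connMat g e' d) x =
      matDeriv e' c (matDeriv e' d (changeMat g e e')) x +
      (matDeriv e' c (pullConn g e e' d) x * changeMat g e e' x +
        pullConn g e e' d x * matDeriv e' c (changeMat g e e') x) := by
    intro c d
    rw [← he'.matDeriv_mul hx hs (he'.smoothMat_conn d),
      ← he'.matDeriv_mul hx (smoothMat_pullConn he he' d) hs,
      ← he'.matDeriv_add hx (he'.smoothMat_matDeriv hs d) ((smoothMat_pullConn he he' d).mul hs)]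
    exact he'.matDeriv_congr hx (fun y hy => connMat_change he he' hy d) c
  have kcd := key c d
  have kdc := key d c
  have hcomm := he'.matDeriv_comm hx hs c d
  have hc : changeMat g e e' x * connMat g e' c x = matDeriv e' c (changeMat g e e') x +
      pullConn g e e' c x * changeMat g e e' x := connMat_change he he' hx c
  have hd : changeMat g e e' x * connMat g e' d x = matDeriv e' d (changeMat g e e') x +
      pullConn g e e' d x * changeMat g e e' x := connMat_change he he' hx d
  have hsum : changeMat g e e' x * (∑ f, struct g e' f c d x • connMat g e' f x) =
      (∑ f, struct g e' f c d x • matDeriv e' f (changeMat g e e') x) +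
      (∑ f, struct g e' f c d x • pullConn g e e' f x) * changeMat g e e' x := by
    rw [Finset.mul_sum, Finset.sum_mul, ← Finset.sum_add_distrib]
    refine Finset.sum_congr rfl fun f _ => ?_
    rw [mul_smul_comm, smul_mul_assoc, ← smul_add, connMat_change he he' hx f]
    rfl
  -- The curvature expression formed from P in the frame `e'` is the curvature of `e` evaluated on
  -- the vectors of `e'`.
  have hpull : matDeriv e' c (pullConn g e e' d) x - matDeriv e' d (pullConn g e e' c) x +
      (pullConn g e e' c x * pullConn g e e' d x - pullConn g e e' d x * pullConn g e e' c x) -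
      (∑ f, struct g e' f c d x • pullConn g e e' f x) =
      ∑ k, ∑ h, (changeMat g e e' x k c * changeMat g e e' x h d) • curvMat g e k h x := by
    have hst : (∑ f, struct g e' f c d x • pullConn g e e' f x) =
        ∑ h, (matDeriv e' c (changeMat g e e') x h d - matDeriv e' d (changeMat g e e') x h c +
          ∑ k, ∑ l, changeMat g e e' x k c * changeMat g e e' x l d * struct g e h k l x) •
            connMat g e h x := by
      simp only [pullConn, Finset.smul_sum, smul_smul]
      rw [Finset.sum_comm]
      refine Finset.sum_congr rfl fun h _ => ?_
      rw [← Finset.sum_smul, struct_change he he' hx]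
      congr 1
      rw [connChange_apply, connChange_apply]
      simp only [conn_torsion, mul_sub, Finset.sum_sub_distrib]
      rw [Finset.sum_comm (f := fun k l =>
        changeMat g e e' x k c * changeMat g e e' x l d * conn g e h l k x)]
      simp only [matDeriv, Matrix.of_apply, Fin.sum_univ_three]
      ring
    rw [hst, matDeriv_pullConn he he' hx, matDeriv_pullConn he he' hx]
    simp only [curvMat_eq, pullConn]
    ext i j
    simp only [Matrix.sum_apply, Matrix.add_apply, Matrix.sub_apply, Matrix.smul_apply,
      Matrix.mul_apply, smul_eq_mul]
    simp only [Fin.sum_univ_three]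
    ring
  rw [← hpull, curvMat_eq]
  simp only [Matrix.mul_sub, Matrix.mul_add, hsum, ← Matrix.mul_assoc, hc, hd, ← hcomm]
  rw [← eq_sub_iff_add_eq'] at kcd kdc
  rw [kcd, kdc]
  simp only [Matrix.add_mul, Matrix.sub_mul, Matrix.mul_assoc, hc, hd, Matrix.mul_add]
  abel

lemma riem_change (he : IsMovingFrame g e U) (he' : IsMovingFrame g e' U) (hx : x ∈ U)
    (a b c d : Fin 3) : riem g e' a b c d x =
      ∑ i, ∑ j, ∑ k, ∑ l, changeMat g e e' x i a * changeMat g e e' x j b *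
        changeMat g e e' x k c * changeMat g e e' x l d * riem g e i j k l x := by
  have h1 : ∀ (e : Frame M) a b c d, riem g e a b c d x = (eta * curvMat g e c d x) a b := by
    intro e a b c d
    simp only [riem, Matrix.mul_apply, curvMat, Matrix.of_apply]
  have h2 : eta * curvMat g e' c d x = ∑ k, ∑ l, (changeMat g e e' x k c *
      changeMat g e e' x l d) • ((changeMat g e e' x)ᵀ * (eta * curvMat g e k l x) *
        changeMat g e e' x) := by
    conv_lhs => rw [← changeMat_orth he he' hx]
    rw [Matrix.mul_assoc, curvMat_change he he' hx]
    simp only [Finset.sum_mul, Finset.mul_sum, smul_mul_assoc, mul_smul_comm, Matrix.mul_assoc]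
  simp only [h1, h2, Matrix.sum_apply, Matrix.smul_apply, smul_eq_mul]
  simp only [Matrix.mul_apply (M := _ * _), Matrix.mul_apply (M := _ᵀ), Matrix.transpose_apply,
    Finset.sum_mul, Finset.mul_sum]
  simp only [Fin.sum_univ_three]
  ring

end

/-! ### Constant rotations -/

/-- The components of a covariant tensor in the basis `e_a X^a_b`. -/
def pullTensor {k : ℕ} (X : Matrix (Fin 3) (Fin 3) ℝ) (T : (Fin k → Fin 3) → ℝ)
    (a : Fin k → Fin 3) : ℝ := ∑ b : Fin k → Fin 3, (∏ i, X (b i) (a i)) * T b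

/-- The substitution (b, c) ↦ (`update b i c`, b i) is an involution exchanging the two arguments of
`F`. -/
lemma sum_sum_update {k n : ℕ} (i : Fin k) (F : (Fin k → Fin n) → (Fin k → Fin n) → ℝ) :
    ∑ b : Fin k → Fin n, ∑ c, F b (Function.update b i c) =
      ∑ b : Fin k → Fin n, ∑ c, F (Function.update b i c) b := by
  rw [← Fintype.sum_prod_type' (f := fun b c => F b (Function.update b i c)),
    ← Fintype.sum_prod_type' (f := fun b c => F (Function.update b i c) b)]
  refine Finset.sum_bij' (fun p _ => (Function.update p.1 i p.2, p.1 i))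
    (fun p _ => (Function.update p.1 i p.2, p.1 i)) ?_ ?_ ?_ ?_ ?_ <;> simp

lemma sum_fin_succ_snoc {k n : ℕ} (F : (Fin (k + 1) → Fin n) → ℝ) :
    ∑ b, F b = ∑ d, ∑ b : Fin k → Fin n, F (Fin.snoc b d) := by
  rw [← Fintype.sum_prod_type' (f := fun d (b : Fin k → Fin n) => F (Fin.snoc b d))]
  exact (Fintype.sum_equiv (Fin.snocEquiv (fun _ => Fin n)) _ _ fun p => rfl).symm

lemma sum_fin_succ_cons {k n : ℕ} (F : (Fin (k + 1) → Fin n) → ℝ) :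
    ∑ b, F b = ∑ d, ∑ b : Fin k → Fin n, F (Matrix.vecCons d b) := by
  rw [← Fintype.sum_prod_type' (f := fun d (b : Fin k → Fin n) => F (Matrix.vecCons d b))]
  exact (Fintype.sum_equiv (Fin.consEquiv (fun _ => Fin n)) _ _ fun p => rfl).symm

lemma sum_fin_four {n : ℕ} (F : (Fin 4 → Fin n) → ℝ) :
    ∑ b, F b = ∑ i, ∑ j, ∑ k, ∑ l, F ![i, j, k, l] := by
  simp only [sum_fin_succ_cons, Fintype.sum_unique]
  simp [Subsingleton.elim (default : Fin 0 → Fin n) ![]]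

lemma pullTensor_succ {k : ℕ} (X : Matrix (Fin 3) (Fin 3) ℝ) (T : (Fin (k + 1) → Fin 3) → ℝ)
    (a : Fin (k + 1) → Fin 3) :
    pullTensor X T a = ∑ d, X d (a (Fin.last k)) *
      pullTensor X (fun b => T (Fin.snoc b d)) (Fin.init a) := by
  rw [pullTensor, sum_fin_succ_snoc]
  refine Finset.sum_congr rfl fun d _ => ?_
  rw [pullTensor, Finset.mul_sum]
  refine Finset.sum_congr rfl fun b _ => ?_
  rw [Fin.prod_univ_castSucc]
  simp only [Fin.snoc_castSucc, Fin.snoc_last, Fin.init]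
  ring

lemma pullTensor_sub {k : ℕ} (X : Matrix (Fin 3) (Fin 3) ℝ) (T S : (Fin k → Fin 3) → ℝ)
    (a : Fin k → Fin 3) :
    pullTensor X (fun b => T b - S b) a = pullTensor X T a - pullTensor X S a := by
  simp [pullTensor, mul_sub, Finset.sum_sub_distrib]

lemma pullTensor_smul {k : ℕ} (X : Matrix (Fin 3) (Fin 3) ℝ) (t : ℝ) (T : (Fin k → Fin 3) → ℝ)
    (a : Fin k → Fin 3) :
    pullTensor X (fun b => t * T b) a = t * pullTensor X T a := by
  simp only [pullTensor, Finset.mul_sum]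
  exact Finset.sum_congr rfl fun _ _ => by ring

lemma pullTensor_sum {k : ℕ} {ι : Type*} (s : Finset ι) (X : Matrix (Fin 3) (Fin 3) ℝ)
    (T : ι → (Fin k → Fin 3) → ℝ) (a : Fin k → Fin 3) :
    pullTensor X (fun b => ∑ i ∈ s, T i b) a = ∑ i ∈ s, pullTensor X (T i) a := by
  simp only [pullTensor, Finset.mul_sum]
  exact Finset.sum_comm

/-- The derivation of the tensor algebra defined by an endomorphism `e_a ↦ A^b_a e_b`. -/
def infAct {k : ℕ} (A : Matrix (Fin 3) (Fin 3) ℝ) (T : (Fin k → Fin 3) → ℝ)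
    (a : Fin k → Fin 3) : ℝ := ∑ i, ∑ b, A b (a i) * T (Function.update a i b)

lemma infAct_sum_smul {k : ℕ} {ι : Type*} (s : Finset ι) (t : ι → ℝ)
    (A : ι → Matrix (Fin 3) (Fin 3) ℝ) (T : (Fin k → Fin 3) → ℝ) (a : Fin k → Fin 3) :
    infAct (∑ j ∈ s, t j • A j) T a = ∑ j ∈ s, t j * infAct (A j) T a := by
  simp only [infAct, Matrix.sum_apply, Matrix.smul_apply, smul_eq_mul, Finset.sum_mul,
    Finset.mul_sum]
  rw [Finset.sum_comm (s := s)]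
  refine Finset.sum_congr rfl fun i _ => ?_
  rw [Finset.sum_comm]
  exact Finset.sum_congr rfl fun _ _ => Finset.sum_congr rfl fun _ _ => by ring

/-- A change of basis conjugates the endomorphism. The hypothesis expresses A' = X⁻¹ A X without an
inverse and is used in one tensor slot at a time. -/
lemma pullTensor_infAct {k : ℕ} {X A A' : Matrix (Fin 3) (Fin 3) ℝ} (h : X * A' = A * X)
    (T : (Fin k → Fin 3) → ℝ) (a : Fin k → Fin 3) :
    pullTensor X (infAct A T) a = infAct A' (pullTensor X T) a := by
  have h0 : infAct A T = fun b => ∑ i, ∑ c, A c (b i) * T (Function.update b i c) := rfl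
  rw [h0, pullTensor_sum, infAct]
  refine Finset.sum_congr rfl fun i _ => ?_
  have h1 : ∀ c (b : Fin k → Fin 3), ∏ j, X (b j) (Function.update a i c j) =
      X (b i) c * ∏ j ∈ Finset.univ.erase i, X (b j) (a j) := by
    intro c b
    rw [← Finset.mul_prod_erase Finset.univ _ (Finset.mem_univ i)]
    simp only [Function.update_self]
    congr 1
    exact Finset.prod_congr rfl fun j hj => by rw [Function.update_of_ne (Finset.ne_of_mem_erase hj)]
  have h2 : ∀ c (b : Fin k → Fin 3), ∏ j, X (Function.update b i c j) (a j) =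
      X c (a i) * ∏ j ∈ Finset.univ.erase i, X (b j) (a j) := by
    intro c b
    rw [← Finset.mul_prod_erase Finset.univ _ (Finset.mem_univ i)]
    simp only [Function.update_self]
    congr 1
    exact Finset.prod_congr rfl fun j hj => by rw [Function.update_of_ne (Finset.ne_of_mem_erase hj)]
  simp only [pullTensor, Finset.mul_sum]
  conv_rhs => rw [Finset.sum_comm]
  have h3 := sum_sum_update i (fun b b' => (∏ j, X (b j) (a j)) * (A (b' i) (b i) * T b'))
  simp only [Function.update_self, h2] at h3
  rw [h3]
  refine Finset.sum_congr rfl fun (b : Fin k → Fin 3) _ => ?_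
  have h4 : ∑ c, X (b i) c * A' c (a i) = ∑ c, A (b i) c * X c (a i) := by
    simpa only [Matrix.mul_apply] using congrFun₂ h (b i) (a i)
  simp only [h1]
  calc _ = (∑ c, A (b i) c * X c (a i)) * ((∏ j ∈ Finset.univ.erase i, X (b j) (a j)) * T b) := by
        rw [Finset.sum_mul]; exact Finset.sum_congr rfl fun _ _ => by ring
    _ = _ := by
        rw [← h4, Finset.sum_mul]; exact Finset.sum_congr rfl fun _ _ => by ring

section
variable {g : LorentzMetric M} {e e' : Frame M} {U : Set M} {x : M} {f f' : M → ℝ}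
  {X : Matrix (Fin 3) (Fin 3) ℝ}

lemma IsMovingFrame.rotate (he : IsMovingFrame g e U) (hX : Xᵀ * eta * X = eta) :
    IsMovingFrame g (rotate e X) U := by
  refine ⟨he.isOpen, fun a => SmoothField.sum _ fun b _ =>
    (he.smoothField b).smul (SmoothFun.const (X b a)), fun x hx a b => ?_⟩
  simp only [Lorentz3.rotate]
  rw [map_sum, ← hX, Matrix.mul_apply]
  refine Finset.sum_congr rfl fun c _ => ?_
  rw [map_smul, he.inner_sum hx, Matrix.mul_apply]
  simp only [Matrix.transpose_apply, smul_eq_mul]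
  ring

lemma IsMovingFrame.changeMat_rotate (he : IsMovingFrame g e U) (hx : x ∈ U) :
    changeMat g e (Lorentz3.rotate e X) x = X := by
  ext b a
  exact he.frameCoord_sum hx (fun b => X b a) b

/-- For constant `X` the inhomogeneous term drops out, so the connection transforms as a tensor. -/
lemma IsMovingFrame.connMat_rotate (he : IsMovingFrame g e U) (hX : Xᵀ * eta * X = eta)
    (hx : x ∈ U) (a : Fin 3) :
    X * connMat g (Lorentz3.rotate e X) a x = (∑ d, X d a • connMat g e d x) * X := by
  have h := connMat_change he (he.rotate hX) hx a
  have h0 : matDeriv (Lorentz3.rotate e X) a (changeMat g e (Lorentz3.rotate e X)) x = 0 := by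
    ext i j
    rw [matDeriv, Matrix.of_apply, (he.rotate hX).frameDeriv_congr hx (f' := fun _ => X i j)
      (fun y hy => by rw [he.changeMat_rotate hy])]
    exact frameDeriv_const _ _ _ _
  rw [connChange, he.changeMat_rotate hx, h0, zero_add] at h
  exact h

lemma covDeriv_eq (g : LorentzMetric M) (e : Frame M) {k : ℕ} (T : (Fin k → Fin 3) → M → ℝ)
    (a : Fin (k + 1) → Fin 3) (x : M) :
    covDeriv g e T a x = frameDeriv e (a (Fin.last k)) (T (Fin.init a)) x -
      infAct (connMat g e (a (Fin.last k)) x) (fun b => T b x) (Fin.init a) := rfl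

lemma IsMovingFrame.covDeriv_rotate (he : IsMovingFrame g e U) (hX : Xᵀ * eta * X = eta)
    (hx : x ∈ U) {k : ℕ} {T T' : (Fin k → Fin 3) → M → ℝ} (hT : ∀ a, SmoothFun U (T a))
    (h : ∀ y ∈ U, ∀ a, T' a y = pullTensor X (fun b => T b y) a) (a : Fin (k + 1) → Fin 3) :
    covDeriv g (Lorentz3.rotate e X) T' a x =
      pullTensor X (fun b => covDeriv g e T b x) a := by
  rw [covDeriv_eq, pullTensor_succ]
  simp only [covDeriv_eq, Fin.snoc_last, Fin.init_snoc, pullTensor_sub, mul_sub,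
    Finset.sum_sub_distrib]
  congr 1
  · rw [(he.rotate hX).frameDeriv_congr hx (fun y hy => h y hy _), he.frameDeriv_change hx,
      he.changeMat_rotate hx]
    refine Finset.sum_congr rfl fun d _ => ?_
    congr 1
    simp only [pullTensor]
    rw [he.frameDeriv_sum hx (fun b _ => (SmoothFun.const _).mul (hT b))]
    exact Finset.sum_congr rfl fun b _ => he.frameDeriv_const_mul hx (hT b) _ _
  · have h1 := pullTensor_infAct (he.connMat_rotate hX hx (a (Fin.last k)))
      (fun b => T b x) (Fin.init a)
    have h2 : (fun b => T' b x) = pullTensor X (fun b => T b x) := funext fun b => h x hx b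
    rw [h2, ← h1]
    simp only [← pullTensor_smul, ← pullTensor_sum]
    congr 1
    funext b
    rw [infAct_sum_smul]

/-- This makes the lifted map polynomial in the group variable, with coefficients the curvature
components of the fixed frame `e`. It is what allows the lifted map to be differentiated. -/
lemma IsMovingFrame.curvComp_rotate (he : IsMovingFrame g e U) (hX : Xᵀ * eta * X = eta) :
    ∀ (k : ℕ), ∀ x ∈ U, ∀ a : Fin (4 + k) → Fin 3,
      curvComp g (Lorentz3.rotate e X) k a x = pullTensor X (fun b => curvComp g e k b x) a
  | 0, x, hx, a => by
    simp only [curvComp, riem_change he (he.rotate hX) hx, he.changeMat_rotate hx, pullTensor]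
    rw [sum_fin_four]
    simp [Fin.prod_univ_four]
  | k + 1, x, hx, a =>
    he.covDeriv_rotate hX hx (he.smooth_curvComp k) (fun y hy => he.curvComp_rotate hX k y hy) a

end

/-! ### Velocities of the lifted curvature map -/

/-- Basis of the Lie algebra of `O(η)`: the boost, the null rotation about `e₀`, and the null
rotation about `e₂`. -/
def soGen : Fin 3 → Matrix (Fin 3) (Fin 3) ℝ :=
  ![!![1, 0, 0; 0, 0, 0; 0, 0, -1], !![0, 1, 0; 0, 0, 2; 0, 0, 0],
    !![0, 0, 0; 1, 0, 0; 0, 1 / 2, 0]]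

lemma eq_sum_soGen {A : Matrix (Fin 3) (Fin 3) ℝ} (h : Aᵀ * eta + eta * A = 0) :
    A = ∑ i, ![A 0 0, A 0 1, A 1 0] i • soGen i := by
  have h' := fun i j => congrFun₂ h i j
  have h00 := h' 0 0
  have h01 := h' 0 1
  have h02 := h' 0 2
  have h11 := h' 1 1
  have h12 := h' 1 2
  have h22 := h' 2 2
  simp only [Matrix.add_apply, Matrix.mul_apply, Matrix.transpose_apply,
    Fin.sum_univ_three] at h00 h01 h02 h11 h12 h22
  simp [eta] at h00 h01 h02 h11 h12 h22
  ext i j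
  fin_cases i <;> fin_cases j <;> simp [soGen, Fin.sum_univ_three] <;> linarith

/-- The left side is what the product rule gives for `pullTensor` at X = 1. In the i-th term only
multi-indices agreeing with `a` away from `i` survive. -/
lemma infAct_eq_sum {k : ℕ} (A : Matrix (Fin 3) (Fin 3) ℝ) (T : (Fin k → Fin 3) → ℝ)
    (a : Fin k → Fin 3) :
    ∑ c : Fin k → Fin 3, (∑ i, (∏ j ∈ Finset.univ.erase i,
      (1 : Matrix (Fin 3) (Fin 3) ℝ) (c j) (a j)) • A (c i) (a i)) * T c = infAct A T a := by
  simp only [Finset.sum_mul]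
  rw [Finset.sum_comm, infAct]
  refine Finset.sum_congr rfl fun i _ => ?_
  symm
  refine Finset.sum_of_injOn (fun d => Function.update a i d) ?_ (by simp) ?_ ?_
  · exact (Function.update_injective a i).injOn
  · intro c _ hc
    have : ∃ j, j ≠ i ∧ c j ≠ a j := by
      by_contra! hcon
      refine hc ⟨c i, by simp, ?_⟩
      ext1 j
      by_cases hj : j = i
      · subst hj; simp
      · simp [Function.update_of_ne hj, hcon j hj]
    obtain ⟨j, hj, hne⟩ := this
    have h0 : ∏ j ∈ Finset.univ.erase i, (1 : Matrix (Fin 3) (Fin 3) ℝ) (c j) (a j) = 0 :=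
      Finset.prod_eq_zero (i := j) (by simp [hj]) (Matrix.one_apply_ne hne)
    rw [h0]
    simp
  · intro d _
    rw [Finset.prod_congr rfl (g := fun _ => (1 : ℝ)) fun j hj => by
      rw [Function.update_of_ne (Finset.ne_of_mem_erase hj), Matrix.one_apply_eq]]
    simp

section
variable {g : LorentzMetric M} {e e' : Frame M} {U : Set M} {x : M} {f f' : M → ℝ}
  {X : Matrix (Fin 3) (Fin 3) ℝ}

/-- The derivative of `R^{(p)}` along the frame vector `e_a`. -/
def horizVel (g : LorentzMetric M) (e : Frame M) (p : ℕ) (x : M) (a : Fin 3) : CurvSpace p :=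
  fun k b => frameDeriv e a (curvComp g e k b) x

/-- The infinitesimal action of an endomorphism on `R^{(p)}`. -/
def vertVel (g : LorentzMetric M) (e : Frame M) (p : ℕ) (x : M) (A : Matrix (Fin 3) (Fin 3) ℝ) :
    CurvSpace p := fun k b => infAct A (fun c => curvComp g e k c x) b

lemma IsMovingFrame.mfderiv_eq_sum (he : IsMovingFrame g e U) (hx : x ∈ U)
    (v : TangentSpace (𝓡 3) x) : mfderiv (𝓡 3) 𝓘(ℝ, ℝ) f x v =
      ∑ c, frameCoord g e x c v * frameDeriv e c f x := by
  conv_lhs => rw [he.expand hx v]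
  simp only [map_sum, map_smul, frameDeriv]
  rfl

lemma lorentz_orth (X : lorentzGroup) :
    ((X : GL (Fin 3) ℝ) : Matrix (Fin 3) (Fin 3) ℝ)ᵀ * eta *
      ((X : GL (Fin 3) ℝ) : Matrix (Fin 3) (Fin 3) ℝ) = eta := X.2

lemma hasDerivAt_comp_curve (hU : IsOpen U) {y : ℝ → M} (hx : y 0 ∈ U) (hf : SmoothFun U f)
    (hy : ContMDiffAt 𝓘(ℝ, ℝ) (𝓡 3) ∞ y 0) :
    HasDerivAt (fun t => f (y t))
      (mfderiv (𝓡 3) 𝓘(ℝ, ℝ) f (y 0) (mfderiv 𝓘(ℝ, ℝ) (𝓡 3) y 0 (1 : ℝ))) 0 := by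
  have h1 := (hf.mdiffAt hU hx).hasMFDerivAt
  have h2 := (hy.mdifferentiableAt (by simp)).hasMFDerivAt
  obtain ⟨L, hL, hL1⟩ : ∃ L : ℝ →L[ℝ] ℝ, HasFDerivAt (fun t => f (y t)) L 0 ∧ L 1 =
      mfderiv (𝓡 3) 𝓘(ℝ, ℝ) f (y 0) (mfderiv 𝓘(ℝ, ℝ) (𝓡 3) y 0 (1 : ℝ)) :=
    ⟨_, (h1.comp 0 h2).hasFDerivAt, rfl⟩
  rw [← hL1]
  exact hL.hasDerivAt

lemma IsMovingFrame.hasDerivAt_lifted (he : IsMovingFrame g e U) (p : ℕ) {y : ℝ → M}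
    {X : ℝ → lorentzGroup} {A : Matrix (Fin 3) (Fin 3) ℝ} (hx : y 0 ∈ U)
    (hy : ContMDiffAt 𝓘(ℝ, ℝ) (𝓡 3) ∞ y 0)
    (hX : ∀ a b, HasDerivAt (fun t => ((X t : lorentzGroup) : GL (Fin 3) ℝ).val a b) (A a b) 0)
    (hX0 : X 0 = 1) :
    HasDerivAt (fun t => liftedCurvJet g e p (y t) (X t))
      (∑ a, frameCoord g e (y 0) a (mfderiv 𝓘(ℝ, ℝ) (𝓡 3) y 0 (1 : ℝ)) •
        horizVel g e p (y 0) a + vertVel g e p (y 0) A) 0 := by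
  rw [hasDerivAt_pi]
  intro k
  rw [hasDerivAt_pi]
  intro b
  have hev : (fun t => liftedCurvJet g e p (y t) (X t) k b) =ᶠ[𝓝 0] fun t =>
      ∑ c : Fin (4 + (k : ℕ)) → Fin 3, (∏ i, ((X t : lorentzGroup) : GL (Fin 3) ℝ).val (c i) (b i)) *
        curvComp g e k c (y t) := by
    filter_upwards [hy.continuousAt.preimage_mem_nhds (he.mem_nhds hx)] with t ht
    exact he.curvComp_rotate (lorentz_orth (X t)) k (y t) ht b
  refine HasDerivAt.congr_of_eventuallyEq ?_ hev
  have hmul : ∀ c : Fin (4 + (k : ℕ)) → Fin 3, HasDerivAt (fun t =>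
      (∏ i, ((X t : lorentzGroup) : GL (Fin 3) ℝ).val (c i) (b i)) * curvComp g e k c (y t)) _ 0 :=
    fun c => (HasDerivAt.fun_finsetProd fun i _ => hX (c i) (b i)).mul
      (hasDerivAt_comp_curve he.isOpen hx (he.smooth_curvComp k c) hy)
  refine (HasDerivAt.fun_sum fun c _ => hmul c).congr_deriv ?_
  have h1 : ((X 0 : lorentzGroup) : GL (Fin 3) ℝ).val = 1 := by rw [hX0]; rfl
  simp only [h1]
  rw [Finset.sum_add_distrib, infAct_eq_sum]
  simp only [Pi.add_apply, Finset.sum_apply, Pi.smul_apply, smul_eq_mul]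
  rw [add_comm]
  congr 1
  rw [Finset.sum_eq_single b]
  · simp only [Matrix.one_apply_eq, Finset.prod_const_one]
    exact (one_mul _).trans (he.mfderiv_eq_sum hx _)
  · intro c _ hc
    obtain ⟨i, hi⟩ := Function.ne_iff.1 hc
    have h0 : ∏ i, (1 : Matrix (Fin 3) (Fin 3) ℝ) (c i) (b i) = 0 :=
      Finset.prod_eq_zero (Finset.mem_univ i) (Matrix.one_apply_ne hi)
    rw [h0]
    exact zero_mul _
  · simp

/-- Differentiate Xᵀ η X = η at the identity. -/
lemma skew_of_curve {X : ℝ → lorentzGroup} {A : Matrix (Fin 3) (Fin 3) ℝ}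
    (hX : ∀ a b, HasDerivAt (fun t => ((X t : lorentzGroup) : GL (Fin 3) ℝ).val a b) (A a b) 0)
    (hX0 : X 0 = 1) : Aᵀ * eta + eta * A = 0 := by
  ext i j
  have h1 : HasDerivAt (fun t => ∑ k, (∑ l, ((X t : lorentzGroup) : GL (Fin 3) ℝ).val l i *
      eta l k) * ((X t : lorentzGroup) : GL (Fin 3) ℝ).val k j) _ 0 :=
    HasDerivAt.fun_sum fun k _ =>
      (HasDerivAt.fun_sum fun l _ => (hX l i).mul_const (eta l k)).mul (hX k j)
  have h2 : (fun t => ∑ k, (∑ l, ((X t : lorentzGroup) : GL (Fin 3) ℝ).val l i *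
      eta l k) * ((X t : lorentzGroup) : GL (Fin 3) ℝ).val k j) = fun _ => eta i j := by
    funext t
    rw [← congrFun₂ (lorentz_orth (X t)) i j]
    simp only [Matrix.mul_apply, Matrix.transpose_apply]
  rw [h2] at h1
  have h3 := h1.unique (hasDerivAt_const 0 (eta i j))
  have h4 : ((X 0 : lorentzGroup) : GL (Fin 3) ℝ).val = 1 := by rw [hX0]; rfl
  simp only [h4] at h3
  refine Eq.trans ?_ h3
  simp only [Matrix.add_apply, Matrix.mul_apply, Matrix.transpose_apply]
  simp only [Fin.sum_univ_three, Matrix.one_apply]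
  fin_cases i <;> fin_cases j <;> (simp; ring)

lemma IsMovingFrame.hasDerivAt_of_velocity (he : IsMovingFrame g e U) (hx : x ∈ U) {y : ℝ → M}
    {X : ℝ → lorentzGroup} (p : ℕ) (hy : ContMDiffAt 𝓘(ℝ, ℝ) (𝓡 3) ∞ y 0)
    (hX : ∀ a b, ContDiffAt ℝ ∞ (fun t => ((X t : lorentzGroup) : GL (Fin 3) ℝ).val a b) 0)
    (hy0 : y 0 = x) (hX0 : X 0 = 1) :
    ∃ t u : Fin 3 → ℝ, HasDerivAt (fun t => liftedCurvJet g e p (y t) (X t))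
      (∑ a, t a • horizVel g e p x a + ∑ i, u i • vertVel g e p x (soGen i)) 0 := by
  subst hy0
  obtain ⟨A, hA⟩ : ∃ A : Matrix (Fin 3) (Fin 3) ℝ, ∀ a b,
      HasDerivAt (fun t => ((X t : lorentzGroup) : GL (Fin 3) ℝ).val a b) (A a b) 0 :=
    ⟨Matrix.of fun a b => deriv (fun t => ((X t : lorentzGroup) : GL (Fin 3) ℝ).val a b) 0,
      fun a b => ((hX a b).differentiableAt (by simp)).hasDerivAt⟩
  have h := he.hasDerivAt_lifted p hx hy hA hX0
  have hv : vertVel g e p (y 0) A =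
      ∑ i, ![A 0 0, A 0 1, A 1 0] i • vertVel g e p (y 0) (soGen i) := by
    conv_lhs => rw [eq_sum_soGen (skew_of_curve hA hX0)]
    ext k b
    simp only [vertVel, infAct_sum_smul, Finset.sum_apply, Pi.smul_apply, smul_eq_mul]
  rw [hv] at h
  exact ⟨_, _, h⟩

/-- Six generators suffice for the upper rank bounds. The lower bound needs only two vertical ones,
realized by `vertVel_mem`. -/
lemma IsMovingFrame.span_velocities_le (he : IsMovingFrame g e U) (hx : x ∈ U) (p : ℕ) :
    Submodule.span ℝ (liftedVelocities g e p x) ≤ Submodule.span ℝ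
      (Set.range (horizVel g e p x) ∪ Set.range (fun i => vertVel g e p x (soGen i))) := by
  rw [Submodule.span_le]
  rintro w ⟨y, X, hy, hX, hy0, hX0, rfl⟩
  obtain ⟨t, u, h⟩ := he.hasDerivAt_of_velocity hx p hy hX hy0 hX0
  rw [h.deriv]
  refine Submodule.add_mem _ (Submodule.sum_mem _ fun a _ => Submodule.smul_mem _ _ ?_)
    (Submodule.sum_mem _ fun a _ => Submodule.smul_mem _ _ ?_)
  · exact Submodule.subset_span (Or.inl ⟨a, rfl⟩)
  · exact Submodule.subset_span (Or.inr ⟨a, rfl⟩)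

/-- Forgetting the top-order component. -/
def truncate (p : ℕ) : CurvSpace (p + 1) →ₗ[ℝ] CurvSpace p where
  toFun T := fun k a => T k.castSucc a
  map_add' _ _ := rfl
  map_smul' _ _ := rfl

lemma IsMovingFrame.rank_mono (he : IsMovingFrame g e U) (hx : x ∈ U) (p : ℕ) :
    liftedRankAt g e p x ≤ liftedRankAt g e (p + 1) x := by
  have h : liftedVelocities g e p x ⊆ truncate p '' liftedVelocities g e (p + 1) x := by
    rintro w ⟨y, X, hy, hX, hy0, hX0, rfl⟩
    -- Genuine differentiability at order p + 1 is needed: it ensures that `deriv` commutes with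
    -- truncation and is not a default value.
    obtain ⟨t, u, h⟩ := he.hasDerivAt_of_velocity hx (p + 1) hy hX hy0 hX0
    refine ⟨_, ⟨y, X, hy, hX, hy0, hX0, rfl⟩, ?_⟩
    rw [h.deriv]
    symm
    refine HasDerivAt.deriv ?_
    rw [hasDerivAt_pi]
    intro k
    exact (hasDerivAt_pi.1 h) k.castSucc
  refine (Submodule.finrank_mono (Submodule.span_mono h)).trans ?_
  rw [Submodule.span_image]
  exact Submodule.finrank_map_le _ _

/-- A matrix preserving `η` as an element of `O(η)`. -/
def lorentzOf (X : Matrix (Fin 3) (Fin 3) ℝ) (h : Xᵀ * eta * X = eta) : lorentzGroup :=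
  ⟨Matrix.GeneralLinearGroup.mkOfDetNeZero X (fun h0 => by
    have := congrArg Matrix.det h
    rw [Matrix.det_mul, h0, mul_zero] at this
    simp [eta, Matrix.det_fin_three] at this), h⟩

lemma IsMovingFrame.vertVel_mem (he : IsMovingFrame g e U) (hx : x ∈ U) (p : ℕ)
    {A : Matrix (Fin 3) (Fin 3) ℝ} (X : ℝ → Matrix (Fin 3) (Fin 3) ℝ)
    (hX : ∀ t, (X t)ᵀ * eta * X t = eta) (hX0 : X 0 = 1)
    (hXs : ∀ a b, ContDiffAt ℝ ∞ (fun t => X t a b) 0)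
    (hXd : ∀ a b, HasDerivAt (fun t => X t a b) (A a b) 0) :
    vertVel g e p x A ∈ Submodule.span ℝ (liftedVelocities g e p x) := by
  refine Submodule.subset_span ⟨fun _ => x, fun t => lorentzOf (X t) (hX t), contMDiffAt_const,
    hXs, rfl, ?_, ?_⟩
  · ext i j
    change X 0 i j = (1 : Matrix (Fin 3) (Fin 3) ℝ) i j
    rw [hX0]
  · have h := he.hasDerivAt_lifted p (y := fun _ => x) (X := fun t => lorentzOf (X t) (hX t))
      (A := A) hx contMDiffAt_const hXd (by ext i j; change X 0 i j = (1 : Matrix (Fin 3) (Fin 3) ℝ) i j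
                                            rw [hX0])
    rw [h.deriv, mfderiv_const]
    have : ∀ a, frameCoord g e x a 0 = 0 := fun a => by simp [frameCoord]
    ext k b
    simp only [Pi.add_apply, Finset.sum_apply, Pi.smul_apply]
    change _ = ∑ a, frameCoord g e x a 0 • _ + _
    simp [this]

end

/-! ### Symmetries of the curvature -/

section
variable {g : LorentzMetric M} {e e' : Frame M} {U : Set M} {x : M} {f f' : M → ℝ}
  {X : Matrix (Fin 3) (Fin 3) ℝ}

lemma riemUp_swap (g : LorentzMetric M) (e : Frame M) (a b c d : Fin 3) (x : M) :
    riemUp g e a b d c x = - riemUp g e a b c d x := by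
  simp only [riemUp, conn_torsion, Fin.sum_univ_three]
  ring

lemma riemUp_self (g : LorentzMetric M) (e : Frame M) (a b c : Fin 3) (x : M) :
    riemUp g e a b c c x = 0 := by
  have := riemUp_swap g e a b c c x
  linarith

/-- The curvature endomorphism inherits the skewness of the connection: this and the next five
lemmas parallel those for `conn` and leave nine components. -/
lemma riemUp_two_zero (g : LorentzMetric M) (e : Frame M) (c d : Fin 3) (x : M) :
    riemUp g e 2 0 c d x = 0 := by
  simp only [riemUp, conn_two_zero, conn_two_one, conn_two_two, frameDeriv_const,
    Fin.sum_univ_three]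
  ring

lemma riemUp_one_one (g : LorentzMetric M) (e : Frame M) (c d : Fin 3) (x : M) :
    riemUp g e 1 1 c d x = 0 := by
  simp only [riemUp, conn_one_one, conn_two_one, conn_one_two, frameDeriv_const,
    Fin.sum_univ_three]
  ring

lemma riemUp_zero_two (g : LorentzMetric M) (e : Frame M) (c d : Fin 3) (x : M) :
    riemUp g e 0 2 c d x = 0 := by
  simp only [riemUp, conn_zero_two, conn_one_two, conn_two_two, frameDeriv_const,
    Fin.sum_univ_three]
  ring

lemma riemUp_two_two (g : LorentzMetric M) (e : Frame M) (c d : Fin 3) (x : M) :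
    riemUp g e 2 2 c d x = - riemUp g e 0 0 c d x := by
  simp only [riemUp, conn_two_zero, conn_zero_two, conn_one_two, conn_two_one, conn_two_two,
    frameDeriv_neg, Fin.sum_univ_three]
  ring

lemma IsMovingFrame.riemUp_two_one (he : IsMovingFrame g e U) (hx : x ∈ U) (c d : Fin 3) :
    riemUp g e 2 1 c d x = 1 / 2 * riemUp g e 1 0 c d x := by
  simp only [riemUp, conn_two_zero, conn_one_one, conn_two_one, conn_two_two,
    Fin.sum_univ_three]
  rw [he.frameDeriv_const_mul hx (he.smooth_conn _ _ _),
    he.frameDeriv_const_mul hx (he.smooth_conn _ _ _)]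
  ring

lemma IsMovingFrame.riemUp_one_two (he : IsMovingFrame g e U) (hx : x ∈ U) (c d : Fin 3) :
    riemUp g e 1 2 c d x = 2 * riemUp g e 0 1 c d x := by
  simp only [riemUp, conn_zero_two, conn_one_one, conn_one_two, conn_two_two,
    Fin.sum_univ_three]
  rw [he.frameDeriv_const_mul hx (he.smooth_conn _ _ _),
    he.frameDeriv_const_mul hx (he.smooth_conn _ _ _)]
  ring

lemma IsMovingFrame.frameDeriv_struct (he : IsMovingFrame g e U) (hx : x ∈ U)
    (a b c d : Fin 3) : frameDeriv e a (struct g e b c d) x =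
      frameDeriv e a (conn g e b c d) x - frameDeriv e a (conn g e b d c) x := by
  rw [← he.frameDeriv_sub hx (he.smooth_conn _ _ _) (he.smooth_conn _ _ _)]
  exact he.frameDeriv_congr hx (fun y _ => conn_torsion _ _ _ _ _ _) a

/-- The first Bianchi identity. -/
lemma IsMovingFrame.bianchi_first (he : IsMovingFrame g e U) (hx : x ∈ U) (a b c d : Fin 3) :
    riemUp g e a b c d x + riemUp g e a c d b x + riemUp g e a d b c x = 0 := by
  have h := he.jacobi hx b c d a
  simp only [he.frameDeriv_struct hx] at h
  simp only [conn_torsion, Fin.sum_univ_three] at h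
  simp only [riemUp, conn_torsion, Fin.sum_univ_three]
  linear_combination h

/-- The first Bianchi identity cuts the nine components to six, as many as the Ricci tensor has. -/
lemma IsMovingFrame.riemUp_eqs (he : IsMovingFrame g e U) (hx : x ∈ U) :
    riemUp g e 0 0 1 2 x = riemUp g e 0 1 0 2 x ∧
    riemUp g e 1 0 1 2 x = -2 * riemUp g e 0 1 0 1 x ∧
    riemUp g e 1 0 0 2 x = -2 * riemUp g e 0 0 0 1 x := by
  have h0 := he.bianchi_first hx 0 0 1 2
  have h1 := he.bianchi_first hx 1 0 1 2
  have h2 := he.bianchi_first hx 2 0 1 2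
  rw [riemUp_zero_two, riemUp_swap g e 0 1 0 2] at h0
  rw [riemUp_one_one, he.riemUp_one_two hx] at h1
  rw [riemUp_two_zero, he.riemUp_two_one hx, riemUp_two_two, riemUp_swap g e 1 0 0 2] at h2
  exact ⟨by linarith, by linarith, by linarith⟩

/-! ### The Ricci tensor and adapted frames for type N. -/

/-- The Ricci tensor as a matrix. -/
def ricMat (g : LorentzMetric M) (e : Frame M) (x : M) : Matrix (Fin 3) (Fin 3) ℝ :=
  Matrix.of fun a b => ricci g e a b x

/-- The trace-free Ricci tensor as a matrix. -/
def tfMat (g : LorentzMetric M) (e : Frame M) (x : M) : Matrix (Fin 3) (Fin 3) ℝ :=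
  Matrix.of fun a b => tracefreeRicci g e a b x

lemma ricMat_change (he : IsMovingFrame g e U) (he' : IsMovingFrame g e' U) (hx : x ∈ U) :
    ricMat g e' x = (changeMat g e e' x)ᵀ * ricMat g e x * changeMat g e e' x := by
  set X := changeMat g e e' x with hXdef
  have hY : (etaInv * Xᵀ * eta) * X = 1 := by
    rw [Matrix.mul_assoc, Matrix.mul_assoc, ← Matrix.mul_assoc Xᵀ, hXdef,
      changeMat_orth he he' hx]
    exact mul_eq_one_comm.1 eta_mul_etaInv
  have hY' := mul_eq_one_comm.1 hY
  set Y := etaInv * Xᵀ * eta with hYdef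
  have h1 : ∀ c d, curvMat g e' c d x =
      Y * ((∑ k, ∑ h, (X k c * X h d) • curvMat g e k h x) * X) := by
    intro c d
    rw [← curvMat_change he he' hx, ← Matrix.mul_assoc, hY, Matrix.one_mul]
  ext a b
  have h2 : ricMat g e' x a b = ∑ c, curvMat g e' c b x c a := rfl
  have h3 : ∀ f k, ∑ c, X k c * Y c f = if k = f then 1 else 0 := by
    intro f k
    rw [← Matrix.mul_apply, hY', Matrix.one_apply]
  rw [h2]
  calc ∑ c, curvMat g e' c b x c a
      = ∑ f, ∑ k, ∑ h, (∑ c, X k c * Y c f) * (X h b * ∑ l, curvMat g e k h x f l * X l a) := by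
        simp only [h1, Matrix.mul_apply, Matrix.sum_apply, Matrix.smul_apply, smul_eq_mul]
        simp only [Fin.sum_univ_three]
        ring
    _ = ∑ k, ∑ h, (X h b * ∑ l, curvMat g e k h x k l * X l a) := by
        simp only [h3]
        simp
    _ = _ := by
        simp only [Matrix.mul_apply, Matrix.transpose_apply, ricMat, Matrix.of_apply, ricci,
          curvMat]
        simp only [Fin.sum_univ_three]
        ring

lemma scalarCurv_eq_trace (g : LorentzMetric M) (e : Frame M) (x : M) :
    scalarCurv g e x = (etaInv * ricMat g e x).trace := by
  have h : ∀ a b, etaInv a b = etaInv b a := by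
    intro a b; fin_cases a <;> fin_cases b <;> rfl
  simp only [scalarCurv, Matrix.trace, Matrix.diag, Matrix.mul_apply, ricMat, Matrix.of_apply]
  rw [Finset.sum_comm]
  exact Finset.sum_congr rfl fun a _ => Finset.sum_congr rfl fun b _ => by rw [h]

lemma tfMat_eq (g : LorentzMetric M) (e : Frame M) (x : M) :
    tfMat g e x = ricMat g e x - (scalarCurv g e x / 3) • eta := by
  ext a b
  simp [tfMat, tracefreeRicci, ricMat]

lemma tfMat_change (he : IsMovingFrame g e U) (he' : IsMovingFrame g e' U) (hx : x ∈ U) :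
    tfMat g e' x = (changeMat g e e' x)ᵀ * tfMat g e x * changeMat g e e' x := by
  have hs : scalarCurv g e' x = scalarCurv g e x := by
    rw [scalarCurv_eq_trace, scalarCurv_eq_trace, ricMat_change he he' hx,
      ← Matrix.mul_assoc, ← Matrix.mul_assoc, Matrix.trace_mul_comm, ← Matrix.mul_assoc,
      ← Matrix.mul_assoc, etaInv_of_orth (changeMat_orth he he' hx)]
  rw [tfMat_eq, tfMat_eq, ricMat_change he he' hx, hs, Matrix.mul_sub, Matrix.sub_mul,
    mul_smul_comm, smul_mul_assoc, changeMat_orth he he' hx]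

/-- The Ricci tensor in terms of curvature two-forms. -/
lemma IsMovingFrame.ricci_eqs (he : IsMovingFrame g e U) (hx : x ∈ U) :
    ricci g e 0 0 x = - riemUp g e 1 0 0 1 x ∧
    ricci g e 0 1 x = riemUp g e 0 0 0 1 x ∧
    ricci g e 1 0 x = riemUp g e 0 0 0 1 x ∧
    ricci g e 0 2 x = riemUp g e 0 0 0 2 x - 2 * riemUp g e 0 1 0 1 x ∧
    ricci g e 2 0 x = riemUp g e 0 0 0 2 x - 2 * riemUp g e 0 1 0 1 x ∧
    ricci g e 1 1 x = 2 * riemUp g e 0 1 0 1 x ∧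
    ricci g e 1 2 x = riemUp g e 0 1 0 2 x ∧
    ricci g e 2 1 x = riemUp g e 0 1 0 2 x ∧
    ricci g e 2 2 x = 2 * riemUp g e 0 1 1 2 x := by
  obtain ⟨h0, h1, h2⟩ := he.riemUp_eqs hx
  simp only [ricci, Fin.sum_univ_three, riemUp_self, riemUp_two_zero, riemUp_one_one,
    riemUp_zero_two, riemUp_two_two, he.riemUp_two_one hx, he.riemUp_one_two hx,
    riemUp_swap g e 1 0 0 1, riemUp_swap g e 0 0 0 2, riemUp_swap g e 0 1 0 1,
    riemUp_swap g e 1 0 0 2, riemUp_swap g e 1 0 1 2, riemUp_swap g e 0 0 1 2, h0, h1, h2]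
  refine ⟨?_, ?_, ?_, ?_, ?_, ?_, ?_, ?_, ?_⟩ <;> ring

/-- The curvature of a type N metric in an adapted frame. -/
structure IsAdaptedAt (g : LorentzMetric M) (e : Frame M) (K s : ℝ) (x : M) : Prop where
  ne : s ≠ 0
  a01 : riemUp g e 0 0 0 1 x = 0
  a02 : riemUp g e 0 0 0 2 x = -K
  a12 : riemUp g e 0 0 1 2 x = 0
  b01 : riemUp g e 1 0 0 1 x = 0
  b02 : riemUp g e 1 0 0 2 x = 0
  b12 : riemUp g e 1 0 1 2 x = -K
  c01 : riemUp g e 0 1 0 1 x = K / 2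
  c02 : riemUp g e 0 1 0 2 x = 0
  c12 : riemUp g e 0 1 1 2 x = s

/-- In dimension three the Ricci tensor determines the curvature: K comes from its trace and s is
half of its (2,2) component. -/
lemma IsMovingFrame.isAdaptedAt (he : IsMovingFrame g e U) (hx : x ∈ U)
    (h00 : tfMat g e x 0 0 = 0) (h01 : tfMat g e x 0 1 = 0) (h02 : tfMat g e x 0 2 = 0)
    (h12 : tfMat g e x 1 2 = 0) (h22 : tfMat g e x 2 2 ≠ 0) :
    ∃ K s, IsAdaptedAt g e K s x := by
  obtain ⟨r00, r01, r10, r02, r20, r11, r12, r21, r22⟩ := he.ricci_eqs hx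
  obtain ⟨b0, b1, b2⟩ := he.riemUp_eqs hx
  simp only [tfMat, tracefreeRicci, scalarCurv, Fin.sum_univ_three, Matrix.of_apply,
    r00, r01, r10, r02, r20, r11, r12, r21, r22] at h00 h01 h02 h12 h22
  simp [eta, etaInv] at h00 h01 h02 h12 h22
  refine ⟨2 * riemUp g e 0 1 0 1 x, riemUp g e 0 1 1 2 x, ?_, ?_, ?_, ?_, ?_, ?_, ?_, ?_, ?_, ?_⟩
  · exact h22
  all_goals linarith

/-- A quadruple root makes the trace-free Ricci tensor a multiple of k ⊗ k for a null covector k,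
and a null rotation straightens k. The matrix is constant, so that it preserves constancy of
components in `e'`; adaptation is claimed only at `x`. -/
lemma exists_adapted (hN : IsTypeNAt g x) (he' : IsMovingFrame g e' U) (hx : x ∈ U) :
    ∃ Y : Matrix (Fin 3) (Fin 3) ℝ, Yᵀ * eta * Y = eta ∧
      ∃ K s, IsAdaptedAt g (rotate e' Y) K s x := by
  obtain ⟨e, U', he, hxU, h22, z, hz⟩ := hN
  have heV := he.mono (he.isOpen.inter he'.isOpen) Set.inter_subset_left
  have heV' := he'.mono (he.isOpen.inter he'.isOpen) Set.inter_subset_right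
  have hxV : x ∈ U' ∩ U := ⟨hxU, hx⟩
  set P := tracefreeRicci g e 2 2 x with hP
  set k : Fin 3 → ℝ := ![z ^ 2, -z, 1] with hk
  have hS : tfMat g e x = P • Matrix.vecMulVec k k := by
    obtain ⟨r00, r01, r10, r02, r20, r11, r12, r21, r22⟩ := he.ricci_eqs hxU
    -- Five sample values determine the quartic. The entry S₁₁, absent from it, equals S₀₂ because S
    -- is trace-free.
    have q0 := hz 0
    have q1 := hz 1
    have q2 := hz (-1)
    have q3 := hz 2
    have q4 := hz (-2)
    simp only [petrovQuartic, ← hP] at q0 q1 q2 q3 q4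
    have s00 : tracefreeRicci g e 0 0 x = P * z ^ 4 := by linarith
    have s01 : tracefreeRicci g e 0 1 x = - P * z ^ 3 := by linarith
    have s02 : tracefreeRicci g e 0 2 x = P * z ^ 2 := by linarith
    have s12 : tracefreeRicci g e 1 2 x = - P * z := by linarith
    have s10 : tracefreeRicci g e 1 0 x = tracefreeRicci g e 0 1 x := by
      simp [tracefreeRicci, r10, r01, eta]
    have s20 : tracefreeRicci g e 2 0 x = tracefreeRicci g e 0 2 x := by
      simp [tracefreeRicci, r20, r02, eta]
    have s21 : tracefreeRicci g e 2 1 x = tracefreeRicci g e 1 2 x := by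
      simp [tracefreeRicci, r21, r12, eta]
    have s11 : tracefreeRicci g e 1 1 x = tracefreeRicci g e 0 2 x := by
      simp only [tracefreeRicci, scalarCurv, Fin.sum_univ_three, r00, r01, r10, r02, r20, r11, r12,
        r21, r22]
      simp [eta, etaInv]
      ring
    ext a b
    fin_cases a <;> fin_cases b <;>
      simp [tfMat, hk, s00, s01, s02, s10, s11, s12, s20, s21, ← hP] <;>
      first | ring1 | (left; ring1)
  set X := changeMat g e e' x with hX
  -- This is the null rotation fixing e_2 with parameter chosen so that kᵀ N = (0, 0, 1).
  set N : Matrix (Fin 3) (Fin 3) ℝ := !![1, 0, 0; 2 * z, 1, 0; z ^ 2, z, 1] with hN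
  have hNo : Nᵀ * eta * N = eta := by
    ext a b
    fin_cases a <;> fin_cases b <;>
      simp [hN, eta, Matrix.mul_apply, Fin.sum_univ_three] <;> ring
  set Z := changeMat g e' e x with hZ
  have hZo : Zᵀ * eta * Z = eta := changeMat_orth heV' heV hxV
  have hYo : (Z * N)ᵀ * eta * (Z * N) = eta := by
    rw [Matrix.transpose_mul]
    calc _ = Nᵀ * (Zᵀ * eta * Z) * N := by simp only [Matrix.mul_assoc]
      _ = eta := by rw [hZo, hNo]
  refine ⟨Z * N, hYo, ?_⟩
  have hr := heV'.rotate hYo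
  have hT : tfMat g (rotate e' (Z * N)) x = P • Matrix.single 2 2 1 := by
    rw [tfMat_change heV' hr hxV, heV'.changeMat_rotate hxV, Matrix.transpose_mul]
    calc _ = Nᵀ * (Zᵀ * tfMat g e' x * Z) * N := by simp only [Matrix.mul_assoc]
      _ = _ := by
        rw [← tfMat_change heV' heV hxV, hS]
        ext a b
        fin_cases a <;> fin_cases b <;>
          simp [hN, hk, Matrix.mul_apply, Fin.sum_univ_three,
            Matrix.single] <;> ring
  refine hr.isAdaptedAt hxV ?_ ?_ ?_ ?_ ?_ <;> rw [hT] <;> simp [h22]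

end

/-! ### Curvature in an adapted frame and the bound r_0 ≥ 2. -/

section
variable {g : LorentzMetric M} {e e' : Frame M} {U : Set M} {x : M} {f f' : M → ℝ}
  {X : Matrix (Fin 3) (Fin 3) ℝ} {K s : ℝ}

lemma riem_swap_right (g : LorentzMetric M) (e : Frame M) (a b c d : Fin 3) (x : M) :
    riem g e a b d c x = - riem g e a b c d x := by
  simp only [riem, riemUp_swap g e _ b c d, mul_neg, Finset.sum_neg_distrib]

/-- The two-form `ω¹ ∧ ω²`. -/
def biv : Fin 3 → Fin 3 → ℝ := ![![0, 0, 0], ![0, 0, 1], ![0, -1, 0]]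

/-- Writing the tabulated components through η and ω¹∧ω² exposes the isotropy: `soGen 1` annihilates
both. -/
lemma IsAdaptedAt.riem_eq (he : IsMovingFrame g e U) (hx : x ∈ U) (h : IsAdaptedAt g e K s x)
    (a b c d : Fin 3) : riem g e a b c d x =
      K * (eta a c * eta b d - eta a d * eta b c) + s * (biv a b * biv c d) := by
  have key : ∀ a b, riem g e a b 0 1 x =
        K * (eta a 0 * eta b 1 - eta a 1 * eta b 0) + s * (biv a b * biv 0 1) ∧
      riem g e a b 0 2 x =
        K * (eta a 0 * eta b 2 - eta a 2 * eta b 0) + s * (biv a b * biv 0 2) ∧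
      riem g e a b 1 2 x =
        K * (eta a 1 * eta b 2 - eta a 2 * eta b 1) + s * (biv a b * biv 1 2) := by
    intro a b
    fin_cases a <;> fin_cases b <;>
    simp [riem, Fin.sum_univ_three, eta, riemUp_two_zero, riemUp_one_one, riemUp_zero_two,
      riemUp_two_two, he.riemUp_one_two hx, he.riemUp_two_one hx, h.a01, h.a02, h.a12, h.b01,
      h.b02, h.b12, h.c01, h.c02, h.c12, biv] <;> ring
  have h0 : ∀ c, riem g e a b c c x = 0 := fun c => by
    have := riem_swap_right g e a b c c x
    linarith
  obtain ⟨k01, k02, k12⟩ := key a b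
  fin_cases c <;> fin_cases d
  · simpa [biv] using h0 0
  · exact k01
  · exact k02
  · refine (riem_swap_right g e a b 0 1 x).trans ?_
    rw [k01]; simp [biv]; ring
  · simpa [biv, mul_comm] using h0 1
  · exact k12
  · refine (riem_swap_right g e a b 0 2 x).trans ?_
    rw [k02]; simp [biv]; ring
  · refine (riem_swap_right g e a b 1 2 x).trans ?_
    rw [k12]; simp [biv]; ring
  · simpa [biv, mul_comm] using h0 2

lemma infAct_four (A : Matrix (Fin 3) (Fin 3) ℝ) (r : Fin 3 → Fin 3 → Fin 3 → Fin 3 → ℝ)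
    (a : Fin 4 → Fin 3) :
    infAct A (fun b : Fin 4 → Fin 3 => r (b 0) (b 1) (b 2) (b 3)) a =
      ∑ c, A c (a 0) * r c (a 1) (a 2) (a 3) + ∑ c, A c (a 1) * r (a 0) c (a 2) (a 3) +
      ∑ c, A c (a 2) * r (a 0) (a 1) c (a 3) + ∑ c, A c (a 3) * r (a 0) (a 1) (a 2) c := by
  simp [infAct, Fin.sum_univ_four, Function.update_apply]

/-- The rank of `R̂^{(0)}` is at least two where `R_{1212} ≠ 0`. -/
lemma IsMovingFrame.two_le_rank_zero (he : IsMovingFrame g e U) (hx : x ∈ U)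
    (h : IsAdaptedAt g e K s x) : 2 ≤ liftedRankAt g e 0 x := by
  have hb : vertVel g e 0 x (soGen 0) ∈ Submodule.span ℝ (liftedVelocities g e 0 x) := by
    refine he.vertVel_mem hx 0
      (fun t => !![Real.exp t, 0, 0; 0, 1, 0; 0, 0, Real.exp (-t)]) (fun t => ?_) ?_ ?_ ?_
    · ext a b
      fin_cases a <;> fin_cases b <;>
        simp [eta, Matrix.mul_apply, Fin.sum_univ_three, ← Real.exp_add]
    · ext a b
      fin_cases a <;> fin_cases b <;> simp
    · intro a b
      fin_cases a <;> fin_cases b <;> simp <;> fun_prop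
    · intro a b
      have h1 := Real.hasDerivAt_exp 0
      have h2 := (Real.hasDerivAt_exp (-0)).comp 0 (hasDerivAt_neg (0 : ℝ))
      rw [Real.exp_zero] at h1
      rw [neg_zero, Real.exp_zero, one_mul] at h2
      fin_cases a <;> fin_cases b <;> simp [soGen] <;>
        first | exact hasDerivAt_const _ _ | exact h1 | exact h2
  have hn : vertVel g e 0 x (soGen 2) ∈ Submodule.span ℝ (liftedVelocities g e 0 x) := by
    refine he.vertVel_mem hx 0
      -- The quadratic entry is forced by preservation of η and does not affect the velocity at t =
      -- 0.
      (fun t => !![1, 0, 0; t, 1, 0; 1 / 4 * t ^ 2, 1 / 2 * t, 1]) (fun t => ?_) ?_ ?_ ?_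
    · ext a b
      fin_cases a <;> fin_cases b <;>
        simp [eta, Matrix.mul_apply, Fin.sum_univ_three] <;> ring
    · ext a b
      fin_cases a <;> fin_cases b <;> simp
    · intro a b
      fin_cases a <;> fin_cases b <;> simp <;> fun_prop
    · intro a b
      have h1 := hasDerivAt_id (0 : ℝ)
      have h2 : HasDerivAt (fun t : ℝ => 2⁻¹ * t) 2⁻¹ 0 := by
        simpa using h1.const_mul (2⁻¹ : ℝ)
      have h3 : HasDerivAt (fun t : ℝ => 4⁻¹ * t ^ 2) 0 0 := by
        simpa using ((hasDerivAt_pow 2 (0 : ℝ)).const_mul (4⁻¹ : ℝ))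
      fin_cases a <;> fin_cases b <;> simp [soGen] <;>
        first | exact hasDerivAt_const _ _ | exact h1 | exact h2 | exact h3
  have hv : ∀ i (a : Fin 4 → Fin 3), vertVel g e 0 x (soGen i) 0 a = _ :=
    fun i a => infAct_four (soGen i) (fun a b c d => riem g e a b c d x) a
  have hind : LinearIndependent ℝ ![vertVel g e 0 x (soGen 0), vertVel g e 0 x (soGen 2)] := by
    rw [LinearIndependent.pair_iff]
    intro p q hpq
    -- Component 1212 sees only the boost (value -2s), and component 1202 only the null rotation
    -- (value s).
    have e1 := congrFun (congrFun hpq 0) ![1, 2, 1, 2]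
    have e2 := congrFun (congrFun hpq 0) ![1, 2, 0, 2]
    simp only [Pi.add_apply, Pi.smul_apply, Pi.zero_apply, smul_eq_mul, hv,
      h.riem_eq he hx] at e1 e2
    simp [soGen, Fin.sum_univ_three, eta, biv] at e1 e2
    have hs := h.ne
    tauto
  have h2 := finrank_span_eq_card hind
  rw [Fintype.card_fin] at h2
  refine h2.ge.trans ?_
  refine Submodule.finrank_mono (Submodule.span_le.2 ?_)
  rintro _ ⟨i, rfl⟩
  fin_cases i
  · exact hb
  · exact hn

/-! ### The second Bianchi identity. -/

lemma IsMovingFrame.matDeriv_curvMat (he : IsMovingFrame g e U) (hx : x ∈ U) (a b c : Fin 3) :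
    matDeriv e a (curvMat g e b c) x =
      matDeriv e a (matDeriv e b (connMat g e c)) x - matDeriv e a (matDeriv e c (connMat g e b)) x +
      (matDeriv e a (connMat g e b) x * connMat g e c x +
        connMat g e b x * matDeriv e a (connMat g e c) x -
        (matDeriv e a (connMat g e c) x * connMat g e b x +
          connMat g e c x * matDeriv e a (connMat g e b) x)) -
      ∑ f, (frameDeriv e a (struct g e f b c) x • connMat g e f x +
        struct g e f b c x • matDeriv e a (connMat g e f) x) := by
  have hc := he.smoothMat_conn
  have hd := fun b c => he.smoothMat_matDeriv (hc c) b
  rw [he.matDeriv_congr hx (fun y _ => curvMat_eq g e b c y)]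
  have hsum : ∀ i j, SmoothFun U fun y => (∑ f, struct g e f b c y • connMat g e f y) i j := by
    intro i j
    simp only [Matrix.sum_apply, Matrix.smul_apply, smul_eq_mul]
    exact SmoothFun.sum fun f _ => (he.smooth_struct _ _ _).mul (hc f i j)
  ext i j
  have h1 : frameDeriv e a (fun y => (∑ f, struct g e f b c y • connMat g e f y) i j) x =
      ∑ f, (frameDeriv e a (struct g e f b c) x * connMat g e f x i j +
        struct g e f b c x * matDeriv e a (connMat g e f) x i j) := by
    simp only [Matrix.sum_apply, Matrix.smul_apply, smul_eq_mul]
    rw [he.frameDeriv_sum hx fun f _ => (he.smooth_struct _ _ _).mul (hc f i j)]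
    exact Finset.sum_congr rfl fun f _ =>
      (he.frameDeriv_mul hx (he.smooth_struct f b c) (hc f i j) a).trans (by
        simp only [matDeriv, Matrix.of_apply]; ring)
  have h2 := Matrix.ext_iff.2 (he.matDeriv_mul hx (hc b) (hc c) a) i j
  have h3 := Matrix.ext_iff.2 (he.matDeriv_mul hx (hc c) (hc b) a) i j
  simp only [Matrix.add_apply, Matrix.sub_apply, Matrix.sum_apply, Matrix.smul_apply, smul_eq_mul]
  simp only [Matrix.add_apply] at h2 h3
  rw [← h2, ← h3, ← h1]
  have s1 := (hd b c) i j
  have s2 := (hd c b) i j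
  have s3 := (hc b).mul (hc c) i j
  have s4 := (hc c).mul (hc b) i j
  exact (he.frameDeriv_sub hx ((s1.sub s2).add (s3.sub s4)) (hsum i j) a).trans
    (by rw [he.frameDeriv_add hx (s1.sub s2) (s3.sub s4), he.frameDeriv_sub hx s1 s2,
      he.frameDeriv_sub hx s3 s4]; rfl)

/-- The second Bianchi identity. -/
lemma IsMovingFrame.bianchi_second (he : IsMovingFrame g e U) (hx : x ∈ U) (c d f : Fin 3) :
    (matDeriv e c (curvMat g e d f) x + connMat g e c x * curvMat g e d f x -
        curvMat g e d f x * connMat g e c x - ∑ h, struct g e h c d x • curvMat g e h f x) +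
    (matDeriv e d (curvMat g e f c) x + connMat g e d x * curvMat g e f c x -
        curvMat g e f c x * connMat g e d x - ∑ h, struct g e h d f x • curvMat g e h c x) +
    (matDeriv e f (curvMat g e c d) x + connMat g e f x * curvMat g e c d x -
        curvMat g e c d x * connMat g e f x - ∑ h, struct g e h f c x • curvMat g e h d x) = 0 := by
  -- In the cyclic sum, second derivatives of the connection matrices pair into three commutators.
  -- Derivatives of the structure functions form Jacobi sums multiplying the connection matrices.
  have c1 := he.matDeriv_comm hx (he.smoothMat_conn f) c d
  have c2 := he.matDeriv_comm hx (he.smoothMat_conn c) d f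
  have c3 := he.matDeriv_comm hx (he.smoothMat_conn d) f c
  have hj := fun h => he.jacobi hx c d f h
  have hs : ∀ h a b, struct g e h a b x = - struct g e h b a x := fun h a b => by
    simp only [conn_torsion]; ring
  simp only [he.matDeriv_curvMat hx]
  simp only [curvMat_eq]
  ext i j
  have d1 := Matrix.ext_iff.2 c1 i j
  have d2 := Matrix.ext_iff.2 c2 i j
  have d3 := Matrix.ext_iff.2 c3 i j
  have j0 := hj 0
  have j1 := hj 1
  have j2 := hj 2
  simp only [Fin.sum_univ_three, Matrix.mul_apply, Matrix.add_apply, Matrix.sub_apply, Matrix.zero_apply,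
    Matrix.smul_apply, smul_eq_mul] at d1 d2 d3 j0 j1 j2 ⊢
  simp only [hs _ 0 c, hs _ 1 c, hs _ 2 c, hs _ 0 d, hs _ 1 d, hs _ 2 d, hs _ 0 f, hs _ 1 f, hs _ 2 f]
  linear_combination d1 + d2 + d3 - j0 * connMat g e 0 x i j - j1 * connMat g e 1 x i j -
    j2 * connMat g e 2 x i j

end

/-! ### The first covariant derivative of the curvature. -/

lemma infAct_five (A : Matrix (Fin 3) (Fin 3) ℝ)
    (r : Fin 3 → Fin 3 → Fin 3 → Fin 3 → Fin 3 → ℝ) (a : Fin 5 → Fin 3) :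
    infAct A (fun b : Fin 5 → Fin 3 => r (b 0) (b 1) (b 2) (b 3) (b 4)) a =
      ∑ c, A c (a 0) * r c (a 1) (a 2) (a 3) (a 4) + ∑ c, A c (a 1) * r (a 0) c (a 2) (a 3) (a 4) +
      ∑ c, A c (a 2) * r (a 0) (a 1) c (a 3) (a 4) + ∑ c, A c (a 3) * r (a 0) (a 1) (a 2) c (a 4) +
      ∑ c, A c (a 4) * r (a 0) (a 1) (a 2) (a 3) c := by
  simp [infAct, Fin.sum_univ_five, Function.update_apply]

/-- The covariant derivative `∇_f (ω¹ ∧ ω²)` in terms of `α_f = Γ⁰_{f0}` and `β_f = Γ¹_{f0}`. -/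
def bivDer (α β : ℝ) : Fin 3 → Fin 3 → ℝ := ![![0, 0, -β], ![0, 0, α], ![β, -α, 0]]

section
variable {g : LorentzMetric M} {e e' : Frame M} {U : Set M} {x : M} {f f' : M → ℝ}
  {X : Matrix (Fin 3) (Fin 3) ℝ} {K s : ℝ}

lemma riemUp_eq_sum_riem (g : LorentzMetric M) (e : Frame M) (a b c d : Fin 3) (x : M) :
    riemUp g e a b c d x = ∑ f, etaInv a f * riem g e f b c d x := by
  fin_cases a <;> simp [riem, Fin.sum_univ_three, eta, etaInv]

/-- An η-skew derivation kills the K part and acts by the Leibniz rule on the square of ω¹∧ω². -/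
lemma infAct_curvature {A : Matrix (Fin 3) (Fin 3) ℝ} {α β : ℝ}
    (hA : ∀ a b, ∑ c, (A c a * eta c b + A c b * eta a c) = 0)
    (hF : ∀ a b, ∑ c, (A c a * biv c b + A c b * biv a c) = -bivDer α β a b) (a : Fin 4 → Fin 3) :
    infAct A (fun b : Fin 4 → Fin 3 =>
      K * (eta (b 0) (b 2) * eta (b 1) (b 3) - eta (b 0) (b 3) * eta (b 1) (b 2)) +
        s * (biv (b 0) (b 1) * biv (b 2) (b 3))) a =
      -s * (bivDer α β (a 0) (a 1) * biv (a 2) (a 3) +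
        biv (a 0) (a 1) * bivDer α β (a 2) (a 3)) := by
  refine (infAct_four A (fun a b c d => K * (eta a c * eta b d - eta a d * eta b c) +
    s * (biv a b * biv c d)) a).trans ?_
  generalize a 0 = p, a 1 = q, a 2 = u, a 3 = v
  have h1 := hA p u
  have h2 := hA q v
  have h3 := hA p v
  have h4 := hA q u
  have h5 := hF p q
  have h6 := hF u v
  simp only [Fin.sum_univ_three] at *
  linear_combination K * (h1 * eta q v + h2 * eta p u - h3 * eta q u - h4 * eta p v) +
    s * (h5 * biv u v + h6 * biv p q)

/-- With constant curvature components only the connection term of ∇R remains. The functions Γ⁰_{f1}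
drop out because they multiply the isotropy generator. -/
lemma IsMovingFrame.curvComp_one (he : IsMovingFrame g e U) (hx : x ∈ U)
    (h : ∀ y ∈ U, IsAdaptedAt g e K s y) (a : Fin 5 → Fin 3) :
    curvComp g e 1 a x =
      s * (bivDer (conn g e 0 (a 4) 0 x) (conn g e 1 (a 4) 0 x) (a 0) (a 1) * biv (a 2) (a 3) +
        biv (a 0) (a 1) *
          bivDer (conn g e 0 (a 4) 0 x) (conn g e 1 (a 4) 0 x) (a 2) (a 3)) := by
  have h0 : ∀ y ∈ U, ∀ b : Fin 4 → Fin 3, curvComp g e 0 b y =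
      K * (eta (b 0) (b 2) * eta (b 1) (b 3) - eta (b 0) (b 3) * eta (b 1) (b 2)) +
        s * (biv (b 0) (b 1) * biv (b 2) (b 3)) := fun y hy b => (h y hy).riem_eq he hy _ _ _ _
  have h1 : frameDeriv e (a 4) (curvComp g e 0 (Fin.init a)) x = 0 := by
    rw [he.frameDeriv_congr hx (fun y hy => h0 y hy _), frameDeriv_const]
  have h2 : curvComp g e 1 a x = 0 - infAct (connMat g e (a 4) x)
      (fun b => curvComp g e 0 b x) (Fin.init a) := by
    rw [← h1]; exact covDeriv_eq ..
  rw [h2]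
  simp only [h0 x hx]
  have := infAct_curvature (K := K) (s := s) (A := connMat g e (a 4) x)
    (α := conn g e 0 (a 4) 0 x) (β := conn g e 1 (a 4) 0 x) (fun p q => ?_) (fun p q => ?_)
    (Fin.init a)
  · rw [this]
    simp only [Fin.init]
    simp
  · have := conn_skew g e (a 4) q p x
    rw [← this]
    refine Finset.sum_congr rfl fun c _ => ?_
    have hs : eta c q = eta q c := by fin_cases q <;> fin_cases c <;> simp [eta]
    simp only [connMat, Matrix.of_apply, hs]
    ring
  · fin_cases p <;> fin_cases q <;>
      simp [Fin.sum_univ_three, biv, bivDer, connMat, conn_two_zero, conn_one_one, conn_zero_two,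
        conn_two_one, conn_one_two, conn_two_two]

/-- By the Leibniz rule it is enough that ω¹∧ω² and its covariant derivative be invariant. Once α_0
= β_0 = β_1 = 0, the only obstruction is 2α_1 - β_2. -/
lemma IsMovingFrame.infAct_curvComp_one (he : IsMovingFrame g e U) (hx : x ∈ U)
    (h : ∀ y ∈ U, IsAdaptedAt g e K s y) (h00 : conn g e 0 0 0 x = 0) (h10 : conn g e 1 0 0 x = 0)
    (h11 : conn g e 1 1 0 x = 0) (h12 : conn g e 1 2 0 x = 2 * conn g e 0 1 0 x)
    (a : Fin 5 → Fin 3) : infAct (soGen 1) (fun b : Fin 5 → Fin 3 => curvComp g e 1 b x) a = 0 := by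
  simp only [he.curvComp_one hx h]
  have hF : ∀ a b, ∑ c, (soGen 1 c a * biv c b + soGen 1 c b * biv a c) = 0 := by
    intro a b
    fin_cases a <;> fin_cases b <;> simp [soGen, biv, Fin.sum_univ_three]
  have hG : ∀ a b f, ∑ c, (soGen 1 c a * bivDer (conn g e 0 f 0 x) (conn g e 1 f 0 x) c b +
      soGen 1 c b * bivDer (conn g e 0 f 0 x) (conn g e 1 f 0 x) a c +
      soGen 1 c f * bivDer (conn g e 0 c 0 x) (conn g e 1 c 0 x) a b) = 0 := by
    intro a b f
    fin_cases a <;> fin_cases b <;> fin_cases f <;>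
      simp [soGen, bivDer, Fin.sum_univ_three, h00, h10, h11, h12]
  refine (infAct_five (soGen 1) (fun p q u v w =>
    s * (bivDer (conn g e 0 w 0 x) (conn g e 1 w 0 x) p q * biv u v +
      biv p q * bivDer (conn g e 0 w 0 x) (conn g e 1 w 0 x) u v)) a).trans ?_
  generalize a 0 = p, a 1 = q, a 2 = u, a 3 = v, a 4 = w
  have h1 := hF p q
  have h2 := hF u v
  have h3 := hG p q w
  have h4 := hG u v w
  simp only [Fin.sum_univ_three] at *
  linear_combination s * (h3 * biv u v + h4 * biv p q +
    h1 * bivDer (conn g e 0 w 0 x) (conn g e 1 w 0 x) u v +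
    h2 * bivDer (conn g e 0 w 0 x) (conn g e 1 w 0 x) p q)

/-- The second Bianchi identity in an adapted frame with constant curvature components. -/
lemma IsMovingFrame.bianchi_of_const (he : IsMovingFrame g e U) (hx : x ∈ U)
    (h : ∀ y ∈ U, IsAdaptedAt g e K s y) :
    conn g e 1 0 0 x = 0 ∧ 2 * conn g e 0 0 0 x + conn g e 1 1 0 x = 0 := by
  have hb := he.bianchi_second hx 0 1 2
  have hc : ∀ c d : Fin 3, ∀ y ∈ U, curvMat g e c d y = curvMat g e c d x := by
    intro c d y hy
    ext a b
    simp only [curvMat, Matrix.of_apply, riemUp_eq_sum_riem]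
    simp only [(h y hy).riem_eq he hy, (h x hx).riem_eq he hx]
  have hd : ∀ a c d : Fin 3, matDeriv e a (curvMat g e c d) x = 0 := by
    intro a c d
    rw [he.matDeriv_congr hx (hc c d)]
    ext i j
    exact frameDeriv_const ..
  simp only [hd] at hb
  have hx' := h x hx
  have b00 := Matrix.ext_iff.2 hb 0 0
  have b01 := Matrix.ext_iff.2 hb 0 1
  simp [Fin.sum_univ_three, Matrix.mul_apply, curvMat, connMat, riemUp_self, riemUp_swap g e _ _ 0 2,
    riemUp_swap g e _ _ 1 2, riemUp_swap g e _ _ 0 1, hx'.a01, hx'.a02, hx'.a12, hx'.b01, hx'.b02, hx'.b12, hx'.c01, hx'.c02, hx'.c12,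
    conn_torsion, conn_two_zero, conn_one_one, conn_zero_two,
        conn_two_one, conn_one_two, conn_two_two, riemUp_two_zero, riemUp_one_one, riemUp_zero_two,
      riemUp_two_two, he.riemUp_one_two hx, he.riemUp_two_one hx] at b00 b01
  have hs := hx'.ne
  have h0 : conn g e 1 0 0 x = 0 := by
    refine (mul_eq_zero.1 ?_).resolve_left hs
    linear_combination -b00
  refine ⟨h0, (mul_eq_zero.1 ?_).resolve_left hs⟩
  linear_combination b01

/-! ### Curvature equations for constant α and β. -/

lemma IsMovingFrame.structure_eqs (he : IsMovingFrame g e U) (hx : x ∈ U)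
    (h : ∀ y ∈ U, IsAdaptedAt g e K s y) {α β : Fin 3 → ℝ}
    (hα : ∀ y ∈ U, ∀ f, conn g e 0 f 0 y = α f) (hβ : ∀ y ∈ U, ∀ f, conn g e 1 f 0 y = β f) :
    (α 0 = 0 ∧ β 0 = 0 ∧ β 1 = 0) ∧
      (β 2 - 2 * α 1) * (conn g e 0 0 1 x - β 2 / 2) = 0 ∧
      (β 2 - 2 * α 1) * conn g e 0 1 1 x = - (α 2 * (α 1 + β 2 / 2)) ∧
      frameDeriv e 0 (conn g e 0 2 1) x =
        frameDeriv e 2 (conn g e 0 0 1) x + (2 * conn g e 0 0 1 x - β 2) * conn g e 0 1 1 x := by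
  have d0 : ∀ a f, frameDeriv e a (conn g e 0 f 0) x = 0 := fun a f => by
    rw [he.frameDeriv_congr hx fun y hy => hα y hy f, frameDeriv_const]
  have d1 : ∀ a f, frameDeriv e a (conn g e 1 f 0) x = 0 := fun a f => by
    rw [he.frameDeriv_congr hx fun y hy => hβ y hy f, frameDeriv_const]
  obtain ⟨hb0, hb1⟩ := he.bianchi_of_const hx h
  rw [hβ x hx] at hb0 hb1
  rw [hα x hx] at hb1
  obtain ⟨-, -, a02, a12, b01, -, b12, -, c02, -⟩ := h x hx
  simp only [riemUp, d0, d1, hα x hx, hβ x hx, Fin.sum_univ_three, conn_torsion, conn_two_zero,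
    conn_one_one, conn_zero_two, conn_two_one, conn_one_two, conn_two_two, hb0] at a02 a12 b01 b12 c02
  have hb1' : β 1 = -2 * α 0 := by linarith
  rw [hb1'] at b01
  -- After β_1 = -2α_0 and β_0 = 0 are substituted, R¹_{001} = 0 reduces to 6α_0² = 0.
  have hα0 : α 0 = 0 := by
    have : α 0 ^ 2 = 0 := by linear_combination b01 / 6
    exact pow_eq_zero_iff two_ne_zero |>.1 this
  rw [hα0, mul_zero] at hb1'
  rw [hα0, hb1'] at a12
  rw [hb1'] at b12
  rw [hα0] at a02 c02
  refine ⟨⟨hα0, hb0, hb1'⟩, ?_, ?_, ?_⟩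
  -- R⁰_{002} and R¹_{012} both equal -K, so K cancels from their difference.
  · linear_combination a02 - b12
  · linear_combination a12
  · linear_combination c02

/-- If `β₂ ≠ 2 α₁` then the connection components are annihilated by `e₀` and `[e₀, e_a]` is a
multiple of `e₀`. -/
lemma IsMovingFrame.frameDeriv_zero_conn (he : IsMovingFrame g e U) (hx : x ∈ U)
    (h : ∀ y ∈ U, IsAdaptedAt g e K s y) {α β : Fin 3 → ℝ}
    (hα : ∀ y ∈ U, ∀ f, conn g e 0 f 0 y = α f) (hβ : ∀ y ∈ U, ∀ f, conn g e 1 f 0 y = β f)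
    (hne : β 2 ≠ 2 * α 1) :
    (∀ a b c, frameDeriv e 0 (conn g e a b c) x = 0) ∧
      ∀ a, struct g e 1 0 a x = 0 ∧ struct g e 2 0 a x = 0 := by
  have hne' : β 2 - 2 * α 1 ≠ 0 := sub_ne_zero.2 hne
  -- Dividing by β_2 - 2α_1 makes γ_0 and γ_1 constant. The value γ_0 = β_2/2 then kills both terms
  -- in the equation for e_0(γ_2).
  have hγ0 : ∀ y ∈ U, conn g e 0 0 1 y = β 2 / 2 := fun y hy =>
    sub_eq_zero.1 ((mul_eq_zero.1 (he.structure_eqs hy h hα hβ).2.1).resolve_left hne')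
  have hγ1 : ∀ y ∈ U, conn g e 0 1 1 y = - (α 2 * (α 1 + β 2 / 2)) / (β 2 - 2 * α 1) := fun y hy =>
    (eq_div_iff hne').2 ((mul_comm _ _).trans (he.structure_eqs hy h hα hβ).2.2.1)
  obtain ⟨⟨hα0, hβ0, hβ1⟩, -, -, hγ2⟩ := he.structure_eqs hx h hα hβ
  have d0 : ∀ a f, frameDeriv e a (conn g e 0 f 0) x = 0 := fun a f => by
    rw [he.frameDeriv_congr hx fun y hy => hα y hy f, frameDeriv_const]
  have d1 : ∀ a f, frameDeriv e a (conn g e 1 f 0) x = 0 := fun a f => by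
    rw [he.frameDeriv_congr hx fun y hy => hβ y hy f, frameDeriv_const]
  have d20 : ∀ a, frameDeriv e a (conn g e 0 0 1) x = 0 := fun a => by
    rw [he.frameDeriv_congr hx hγ0, frameDeriv_const]
  have d21 : ∀ a, frameDeriv e a (conn g e 0 1 1) x = 0 := fun a => by
    rw [he.frameDeriv_congr hx hγ1, frameDeriv_const]
  have d2 : ∀ f, frameDeriv e 0 (conn g e 0 f 1) x = 0 := by
    intro f
    fin_cases f
    · exact d20 0
    · exact d21 0
    · refine hγ2.trans ?_
      rw [d20, hγ0 x hx]; ring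
  constructor
  · intro a b c
    fin_cases a <;> fin_cases c <;>
      simp [conn_two_zero, conn_one_one, conn_zero_two, conn_two_one, conn_one_two, conn_two_two,
        frameDeriv_const, frameDeriv_neg, he.frameDeriv_const_mul hx (he.smooth_conn _ _ _), d0, d1,
        d2]
  · intro a
    fin_cases a <;> simp [conn_torsion, conn_two_zero, conn_one_one, conn_zero_two, conn_two_one,
      conn_one_two, conn_two_two, hα x hx, hβ x hx, hα0, hβ0, hβ1, hγ0 x hx]
    ring

/-- If `e₀` annihilates the connection and curvature components and `[e₀, e_a]` is a multiple of
`e₀`, then `e₀` annihilates the components of all covariant derivatives of the curvature. -/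
lemma IsMovingFrame.frameDeriv_zero_curvComp (he : IsMovingFrame g e U)
    (hΓ : ∀ y ∈ U, ∀ a b c, frameDeriv e 0 (conn g e a b c) y = 0)
    (hC : ∀ y ∈ U, ∀ a, struct g e 1 0 a y = 0 ∧ struct g e 2 0 a y = 0)
    (h : ∀ y ∈ U, ∀ b, frameDeriv e 0 (curvComp g e 0 b) y = 0) :
    ∀ (k : ℕ) (b : Fin (4 + k) → Fin 3), ∀ y ∈ U, frameDeriv e 0 (curvComp g e k b) y = 0
  | 0, b, y, hy => h y hy b
  | k + 1, b, y, hy => by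
    have ih := he.frameDeriv_zero_curvComp hΓ hC h k
    have hT := he.smooth_curvComp k
    have hmul : ∀ (i : Fin (4 + k)) (c : Fin 3), SmoothFun U fun z =>
        conn g e c (b (Fin.last _)) (b i.castSucc) z *
          curvComp g e k (Function.update (Fin.init b) i c) z := fun i c =>
      (he.smooth_conn _ _ _).mul (hT _)
    have h1 : frameDeriv e 0 (frameDeriv e (b (Fin.last (4 + k))) (curvComp g e k (Fin.init b))) y
        = 0 := by
      -- Moving e_0 past e_a costs a derivative along [e_0, e_a], a multiple of e_0, which the
      -- induction hypothesis annihilates.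
      have h2 := he.frameDeriv_comm hy (hT (Fin.init b)) 0 (b (Fin.last (4 + k)))
      rw [he.frameDeriv_congr hy (fun z hz => ih (Fin.init b) z hz), frameDeriv_const, sub_zero] at h2
      rw [h2, Fin.sum_univ_three, ih _ y hy, (hC y hy _).1, (hC y hy _).2]
      ring
    refine (he.frameDeriv_sub hy (he.smooth_frameDeriv (hT _) _)
      (SmoothFun.sum fun i _ => SmoothFun.sum fun c _ => hmul i c) 0).trans ?_
    refine (congrArg₂ (· - ·) h1 rfl).trans ?_
    rw [he.frameDeriv_sum hy fun i _ => SmoothFun.sum fun c _ => hmul i c, zero_sub, neg_eq_zero]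
    refine Finset.sum_eq_zero fun i _ => ?_
    rw [he.frameDeriv_sum hy fun c _ => hmul i c]
    refine Finset.sum_eq_zero fun c _ => ?_
    rw [he.frameDeriv_mul hy (he.smooth_conn _ _ _) (hT _), hΓ y hy, ih _ y hy]
    ring

end

/-! ### Constant adapted frames and upper rank bounds. -/

section
variable {g : LorentzMetric M} {e e' : Frame M} {U : Set M} {x : M} {f f' : M → ℝ}
  {X : Matrix (Fin 3) (Fin 3) ℝ} {K s : ℝ}

/-- A function with vanishing differential is constant on a coordinate ball; the ball does not
depend on the function. -/
lemma exists_const_nhds (hU : IsOpen U) (hx : x ∈ U) :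
    ∃ V : Set M, IsOpen V ∧ x ∈ V ∧ V ⊆ U ∧ ∀ f : M → ℝ,
      (∀ y ∈ U, HasMFDerivAt (𝓡 3) 𝓘(ℝ, ℝ) f y 0) → ∀ y ∈ V, f y = f x := by
  set φ := chartAt (EuclideanSpace ℝ (Fin 3)) x with hφ
  have hφx : x ∈ φ.source := mem_chart_source _ x
  have ho : IsOpen (φ.target ∩ φ.symm ⁻¹' U) := φ.symm.isOpen_inter_preimage hU
  obtain ⟨r, hr, hball⟩ := Metric.isOpen_iff.1 ho (φ x)
    ⟨φ.map_source hφx, by simpa [φ.left_inv hφx] using hx⟩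
  refine ⟨φ.source ∩ φ ⁻¹' Metric.ball (φ x) r, φ.isOpen_inter_preimage Metric.isOpen_ball,
    ⟨hφx, Metric.mem_ball_self hr⟩, fun y hy => ?_, fun f hf y hy => ?_⟩
  · have := (hball hy.2).2
    rwa [Set.mem_preimage, φ.left_inv hy.1] at this
  · have hd : ∀ z ∈ Metric.ball (φ x) r, HasFDerivAt (f ∘ φ.symm)
        (0 : EuclideanSpace ℝ (Fin 3) →L[ℝ] ℝ) z := by
      intro z hz
      have h1 : MDifferentiableAt (𝓡 3) (𝓡 3) φ.symm z :=
        (mdifferentiable_chart (I := 𝓡 3) x).mdifferentiableAt_symm (hball hz).1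
      have h2 := (hf _ (hball hz).2).comp z h1.hasMFDerivAt
      refine (hasMFDerivAt_iff_hasFDerivAt.1 h2).congr_fderiv ?_
      ext v
      rfl
    have := (convex_ball (φ x) r).is_const_of_fderivWithin_eq_zero (𝕜 := ℝ) (f := f ∘ φ.symm)
      (fun z hz => (hd z hz).differentiableAt.differentiableWithinAt)
      (fun z hz => (hd z hz).hasFDerivWithinAt.fderivWithin
        (Metric.isOpen_ball.uniqueDiffWithinAt hz)) hy.2 (Metric.mem_ball_self hr)
    simpa [φ.left_inv hy.1, φ.left_inv hφx] using this

lemma IsMovingFrame.hasMFDerivAt_curvComp (he : IsMovingFrame g e U) (hx : x ∈ U) {p : ℕ}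
    (h : jetRankAt g e p x = 0) (k : Fin (p + 1)) (a : Fin (4 + (k : ℕ)) → Fin 3) :
    HasMFDerivAt (𝓡 3) 𝓘(ℝ, ℝ) (curvComp g e k a) x 0 := by
  have hs : ContMDiffAt (𝓡 3) 𝓘(ℝ, CurvSpace p) ∞ (curvJet g e p) x :=
    contMDiffAt_pi_space.2 fun k => contMDiffAt_pi_space.2 fun a =>
      (he.smooth_curvComp k a).contMDiffAt (he.isOpen.mem_nhds hx)
  have h0 : mfderiv (𝓡 3) 𝓘(ℝ, CurvSpace p) (curvJet g e p) x = 0 := by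
    haveI : FiniteDimensional ℝ (TangentSpace 𝓘(ℝ, CurvSpace p) (curvJet g e p x)) :=
      inferInstanceAs (FiniteDimensional ℝ (CurvSpace p))
    have := LinearMap.range_eq_bot.1 (Submodule.finrank_eq_zero.1 h)
    exact ContinuousLinearMap.ext fun v => LinearMap.congr_fun this v
  have hd := (hs.mdifferentiableAt (by simp)).hasMFDerivAt
  rw [h0] at hd
  let P : CurvSpace p →L[ℝ] ℝ :=
    (ContinuousLinearMap.proj (R := ℝ) (φ := fun _ : Fin (4 + (k : ℕ)) → Fin 3 => ℝ) a).comp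
      (ContinuousLinearMap.proj (R := ℝ)
        (φ := fun k : Fin (p + 1) => (Fin (4 + (k : ℕ)) → Fin 3) → ℝ) k)
  exact ((P.hasMFDerivAt (x := curvJet g e p x)).comp x hd).congr_mfderiv
    (ContinuousLinearMap.ext fun v => P.map_zero)

/-- Adaptedness depends on the curvature components alone, so constancy spreads it from a point to a
neighbourhood. -/
lemma IsAdaptedAt.of_riem_eq {y : M} (h : IsAdaptedAt g e K s x)
    (hr : ∀ a b c d, riem g e a b c d y = riem g e a b c d x) : IsAdaptedAt g e K s y := by
  have hu : ∀ a b c d, riemUp g e a b c d y = riemUp g e a b c d x := fun a b c d => by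
    simp only [riemUp_eq_sum_riem, hr]
  obtain ⟨h0, h1, h2, h3, h4, h5, h6, h7, h8, h9⟩ := h
  constructor <;> simpa only [hu]

/-- Near every point of a properly curvature homogeneous manifold of order one there is an adapted
frame with constant components of the curvature and of its first derivative. -/
lemma exists_const_frame (hN : IsTypeNAt g x) (h : HasHorizontalRank g 1 0) :
    ∃ (e : Frame M) (V : Set M) (K s : ℝ), IsMovingFrame g e V ∧ x ∈ V ∧
      (∀ y ∈ V, IsAdaptedAt g e K s y) ∧
      ∀ a : Fin 5 → Fin 3, ∀ y ∈ V, curvComp g e 1 a y = curvComp g e 1 a x := by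
  obtain ⟨S, G, hS, ht⟩ := h
  obtain ⟨e', U, hxU, he'⟩ := hS.cover x
  obtain ⟨V, hVo, hxV, hVU, hV⟩ := exists_const_nhds he'.1.isOpen hxU
  obtain ⟨Y, hY, K, s, hks⟩ := exists_adapted hN he'.1 hxU
  have heV := he'.1.mono hVo hVU
  have hc : ∀ (k : Fin 2) (a : Fin (4 + (k : ℕ)) → Fin 3), ∀ y ∈ V,
      curvComp g e' k a y = curvComp g e' k a x := fun k a =>
    hV _ fun y hy => he'.1.hasMFDerivAt_curvComp hy (ht e' U he' y hy) k a
  have hc' : ∀ (k : Fin 2) (a : Fin (4 + (k : ℕ)) → Fin 3), ∀ y ∈ V,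
      curvComp g (rotate e' Y) k a y = curvComp g (rotate e' Y) k a x := fun k a y hy => by
    rw [heV.curvComp_rotate hY k y hy, heV.curvComp_rotate hY k x hxV]
    simp only [hc k _ y hy]
  exact ⟨rotate e' Y, V, K, s, heV.rotate hY, hxV,
    fun y hy => hks.of_riem_eq fun a b c d => hc' 0 ![a, b, c, d] y hy, fun a => hc' 1 a⟩

lemma IsMovingFrame.rank_le (he : IsMovingFrame g e U) (hx : x ∈ U) {p n : ℕ}
    (w : Fin n → CurvSpace p)
    (hh : ∀ a, horizVel g e p x a ∈ Submodule.span ℝ (Set.range w))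
    (hv : ∀ i, vertVel g e p x (soGen i) ∈ Submodule.span ℝ (Set.range w)) :
    liftedRankAt g e p x ≤ n := by
  refine (Submodule.finrank_mono ((he.span_velocities_le hx p).trans
    (Submodule.span_le.2 (Set.union_subset ?_ ?_)))).trans
    ((finrank_range_le_card (R := ℝ) w).trans_eq (Fintype.card_fin n))
  · rintro _ ⟨a, rfl⟩; exact hh a
  · rintro _ ⟨i, rfl⟩; exact hv i

lemma IsAdaptedAt.infAct_curvComp_zero (h : IsAdaptedAt g e K s x) (he : IsMovingFrame g e U)
    (hx : x ∈ U) (a : Fin 4 → Fin 3) :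
    infAct (soGen 1) (fun b : Fin 4 → Fin 3 => curvComp g e 0 b x) a = 0 := by
  have h0 : ∀ b : Fin 4 → Fin 3, curvComp g e 0 b x =
      K * (eta (b 0) (b 2) * eta (b 1) (b 3) - eta (b 0) (b 3) * eta (b 1) (b 2)) +
        s * (biv (b 0) (b 1) * biv (b 2) (b 3)) := fun b => h.riem_eq he hx _ _ _ _
  have hz : ∀ p q, bivDer 0 0 p q = 0 := fun p q => by
    fin_cases p <;> fin_cases q <;> simp [bivDer]
  simp only [h0]
  rw [infAct_curvature (α := 0) (β := 0)]
  · simp [hz]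
  · intro p q
    fin_cases p <;> fin_cases q <;> simp [soGen, eta, Fin.sum_univ_three]
  · intro p q
    rw [hz]
    fin_cases p <;> fin_cases q <;> simp [soGen, biv, Fin.sum_univ_three]

/-- Either `r_1 ≤ 2` or `r_p ≤ 5` for every `p`. -/
lemma IsMovingFrame.rank_bounds (he : IsMovingFrame g e U) (hx : x ∈ U)
    (h : ∀ y ∈ U, IsAdaptedAt g e K s y)
    (hc : ∀ a : Fin 5 → Fin 3, ∀ y ∈ U, curvComp g e 1 a y = curvComp g e 1 a x) :
    liftedRankAt g e 1 x ≤ 2 ∨ ∀ p, liftedRankAt g e p x ≤ 5 := by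
  have hs := (h x hx).ne
  -- Here R_{1212;f} = 2s α_f; below, R_{0212;f} = -s β_f. Since s ≠ 0, constancy of ∇R gives that
  -- of α and β.
  have hα : ∀ y ∈ U, ∀ f, conn g e 0 f 0 y = conn g e 0 f 0 x := by
    intro y hy f
    have := hc ![1, 2, 1, 2, f] y hy
    rw [he.curvComp_one hx h, he.curvComp_one hy h] at this
    simp [bivDer, biv, hs] at this
    linarith
  have hβ : ∀ y ∈ U, ∀ f, conn g e 1 f 0 y = conn g e 1 f 0 x := by
    intro y hy f
    have := hc ![0, 2, 1, 2, f] y hy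
    rw [he.curvComp_one hx h, he.curvComp_one hy h] at this
    simpa [bivDer, biv, hs] using this
  have hzero : ∀ y ∈ U, ∀ (c : Fin 3) (b : Fin (4 + 0) → Fin 3),
      frameDeriv e c (curvComp g e 0 b) y = 0 := by
    intro y hy c b
    exact (he.frameDeriv_congr hy (fun z hz => (h z hz).riem_eq he hz _ _ _ _) c).trans
      (frameDeriv_const ..)
  -- If β_2 = 2α_1, all horizontal velocities and one vertical velocity vanish at order 1, leaving
  -- two. Otherwise the e_0 velocity vanishes at every order, leaving five.
  by_cases hne : conn g e 1 2 0 x = 2 * conn g e 0 1 0 x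
  · left
    obtain ⟨⟨h00, h10, h11⟩, -⟩ := he.structure_eqs hx h hα hβ
    have hk := he.infAct_curvComp_one hx h h00 h10 h11 hne
    have hh : ∀ a, horizVel g e 1 x a = 0 := by
      intro a
      ext k b
      fin_cases k
      · exact hzero x hx a b
      · refine (he.frameDeriv_congr hx (hc b) a).trans (frameDeriv_const ..)
    have hv : vertVel g e 1 x (soGen 1) = 0 := by
      ext k b
      fin_cases k
      · exact (h x hx).infAct_curvComp_zero he hx b
      · exact hk b
    refine he.rank_le hx ![vertVel g e 1 x (soGen 0), vertVel g e 1 x (soGen 2)]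
      (fun a => by rw [hh]; exact zero_mem _) fun i => ?_
    fin_cases i
    · exact Submodule.subset_span ⟨0, rfl⟩
    · exact hv ▸ zero_mem _
    · exact Submodule.subset_span ⟨1, rfl⟩
  · right
    intro p
    have h0 : horizVel g e p x 0 = 0 := by
      ext k b
      exact he.frameDeriv_zero_curvComp
        (fun y hy => (he.frameDeriv_zero_conn hy h hα hβ hne).1)
        (fun y hy => (he.frameDeriv_zero_conn hy h hα hβ hne).2)
        (fun y hy => hzero y hy 0) k b x hx
    refine he.rank_le hx ![horizVel g e p x 1, horizVel g e p x 2, vertVel g e p x (soGen 0),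
      vertVel g e p x (soGen 1), vertVel g e p x (soGen 2)] (fun a => ?_) fun i => ?_
    · fin_cases a
      · exact h0 ▸ zero_mem _
      · exact Submodule.subset_span ⟨0, rfl⟩
      · exact Submodule.subset_span ⟨1, rfl⟩
    · fin_cases i
      · exact Submodule.subset_span ⟨2, rfl⟩
      · exact Submodule.subset_span ⟨3, rfl⟩
      · exact Submodule.subset_span ⟨4, rfl⟩

end

end Lorentz3

end

/-! ### Counting ranks. -/

theorem mainTheorem6 {M : Type*} [TopologicalSpace M]
    [ChartedSpace (EuclideanSpace ℝ (Fin 3)) M] [IsManifold (𝓡 3) ∞ M]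
    (g : Lorentz3.LorentzMetric M)
    (hreg : Lorentz3.FullyRegular g)
    (hN : Lorentz3.IsTypeN g)
    (hCH : Lorentz3.IsProperlyCH g 1) :
    ∃ m : ℤ, Lorentz3.HasOrder g m ∧ m ≤ 3 := by
  rcases isEmpty_or_nonempty M with hM | ⟨⟨x⟩⟩
  -- On the empty manifold every rank condition is vacuous; the zero sequence gives q = 0.
  · exact ⟨-1, ⟨fun _ => 0, fun _ _ _ _ x => isEmptyElim x, 0, ⟨rfl, fun _ _ => Nat.zero_le _⟩,
      by norm_num⟩, by norm_num⟩
  choose r hr using hreg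
  suffices h : ∃ q ≤ 4, Lorentz3.prevRank r q = r q by
    classical
    obtain ⟨q, hq4, hq⟩ := h
    refine ⟨(Nat.find ⟨q, hq⟩ : ℤ) - 1, ⟨r, hr, _, ⟨Nat.find_spec (⟨q, hq⟩ :
      ∃ q, Lorentz3.prevRank r q = r q), fun n hn => Nat.find_min' _ hn⟩, rfl⟩, ?_⟩
    have := (Nat.find_min' (⟨q, hq⟩ : ∃ q, Lorentz3.prevRank r q = r q) hq).trans hq4
    omega
  by_contra! hne
  obtain ⟨e, V, K, s, he, hx, had, hc⟩ := Lorentz3.exists_const_frame (hN x) hCH.2.1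
  have hrank : ∀ p, Lorentz3.liftedRankAt g e p x = r p := fun p => hr p e V he x hx
  have h0 := he.two_le_rank_zero hx (had x hx)
  have hb := he.rank_bounds hx had hc
  have hm := he.rank_mono hx
  simp only [hrank] at h0 hb hm
  have n1 : r 0 ≠ r 1 := hne 1 (by norm_num)
  have n2 : r 1 ≠ r 2 := hne 2 (by norm_num)
  have n3 : r 2 ≠ r 3 := hne 3 (by norm_num)
  have n4 : r 3 ≠ r 4 := hne 4 (by norm_num)
  have m0 : r 0 ≤ r 1 := hm 0
  have m1 : r 1 ≤ r 2 := hm 1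
  have m2 : r 2 ≤ r 3 := hm 2
  have m3 : r 3 ≤ r 4 := hm 3
  -- Strict growth from r_0 ≥ 2 gives r_1 ≥ 3 and r_4 ≥ 6, contradicting either bound.
  rcases hb with hb | hb
  · omega
  · have := hb 4
    omega
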